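/- Let $\mathbf{M}$ be a complete and cocomplete closed symmetric monoidal category with unit $I$. An \emph{orthogonal category} $\overline{\mathbf{D}}=(\mathbf{D},\perp)$ is a small category $\mathbf{D}$ with a relation $\perp$ on pairs of morphisms $f_1:d_1\to d$, $f_2:d_2\to d$ with a common target that is symmetric and such that $f_1\perp f_2$ implies $gf_1h_1\perp gf_2h_2$ for all composable $g,h_1,h_2$. A functor $F:\mathbf{C}\to\mathbf{D}$ between small categories is a \emph{category fibered in groupoids} if (i) for every object $c'$ of $\mathbf{C}$ and every morphism $g:d\to F(c')$ there is a morphism $f:c\to c'$ with $F(c)=d$ and $F(f)=g$, and (ii) for all $f:c\to c'$, $f'':c''\to c'$ in $\mathbf{C}$ and $g:F(c'')\to F(c)$ in $\mathbf{D}$ with $F(f'')=F(f)\,g$ there is a unique $h:c''\to c$ with $F(h)=g$ and $fh=f''$. Given $(\mathbf{D},\perp)$ and such an $F$, equip $\mathbf{C}$ with the pullback relation $F^*(\perp)$: $f_1$ and $f_2$ are orthogonal iff $F(f_1)\perp F(f_2)$. Then $F:\overline{\mathbf{C}}=(\mathbf{C},F^*(\perp))\to\overline{\mathbf{D}}$ is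 called an \emph{orthogonal category fibered in groupoids}. For an orthogonal category $\overline{\mathbf{C}}$, let $\mathcal{O}_{\overline{\mathbf{C}}}$ be the colored symmetric operad with colors the objects of $\mathbf{C}$ and with operations $$\mathcal{O}_{\overline{\mathbf{C}}}\tbinom{t}{c_1,\dots,c_n}=\Big(\Sigma_n\times\prod_{i=1}^n\mathbf{C}(c_i,t)\Big)\Big/\!\sim_\perp ,$$ where $(\sigma,f)\sim_\perp(\sigma',f')$ iff $f=f'$ and $\sigma\sigma'^{-1}=\tau_1\cdots\tau_N$ for transpositions $\tau_k$ of adjacent entries of the sequence $f\sigma^{-1}\tau_1\cdots\tau_{k-1}$ that are orthogonal; here $f\rho$ denotes the sequence $(f_{\rho(1)},\dots,f_{\rho(n)})$. The permutation action is $[\sigma,f]\cdot\sigma'=[\sigma\sigma',f\sigma']$, the units are $[e,\mathrm{id}_t]$, and the composition is $$\gamma\big([\sigma,f];[\sigma_1,g_1],\dots,[\sigma_m,g_m]\big)=\big[\sigma\langle k_{\sigma^{-1}(1)},\dots,k_{\sigma^{-1}(m)}\rangle(\sigma_1\oplus\cdots\oplus\sigma_m),\,f(g_1,\dots,g_m)\big],$$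 where $k_i$ is the arity of $g_i$, $\langle\cdots\rangle$ is the block permutation, and $f(g_1,\dots,g_m)$ is the sequence of the composites $f_ig_{ij}$. The category $\mathbf{Alg}(\mathcal{O}_{\overline{\mathbf{C}}})$ is the category of algebras with values in $\mathbf{M}$ over this operad (base changed to $\mathbf{M}$ along $S\mapsto\coprod_{S}I$). For an orthogonal functor $F:\overline{\mathbf{C}}\to\overline{\mathbf{D}}$ (one that preserves orthogonality), $\mathcal{O}_F^*:\mathbf{Alg}(\mathcal{O}_{\overline{\mathbf{D}}})\to\mathbf{Alg}(\mathcal{O}_{\overline{\mathbf{C}}})$ is the pullback along the operad morphism $\mathcal{O}_F:[\sigma,f]\mapsto[\sigma,F(f)]$. Let $\mathbf{Mon}_{\mathbf{M}}^{\mathbf{C}}$ be the category of functors from $\mathbf{C}$ to monoids in $\mathbf{M}$, and let $p_{\overline{\mathbf{C}}}^*:\mathbf{Alg}(\mathcal{O}_{\overline{\mathbf{C}}})\to\mathbf{Mon}_{\mathbf{M}}^{\mathbf{C}}$ be the underlying functor: it sends $A$ to the functor $c\mapsto A_c$ with multiplication given by $[e,(\mathrm{id}_c,\mathrm{id}_c)]$,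 unit given by the operation of arity $0$, and $A_c\to A_{c'}$ given by $[e,f]$ for $f:c\to c'$. One has $p_{\overline{\mathbf{C}}}^*\mathcal{O}_F^*=F^*p_{\overline{\mathbf{D}}}^*$, where $F^*:\mathbf{Mon}_{\mathbf{M}}^{\mathbf{D}}\to\mathbf{Mon}_{\mathbf{M}}^{\mathbf{C}}$ is precomposition with $F$; let $\mathrm{Ran}_F$ be the right adjoint of $F^*$ given by right Kan extension. \textbf{Proposition.} Let $F:\overline{\mathbf{C}}\to\overline{\mathbf{D}}$ be an orthogonal category fibered in groupoids. Then $\mathcal{O}_F^*:\mathbf{Alg}(\mathcal{O}_{\overline{\mathbf{D}}})\to\mathbf{Alg}(\mathcal{O}_{\overline{\mathbf{C}}})$ has a right adjoint $\mathcal{O}_{F*}$ (the orbifoldization functor). Moreover, $\mathcal{O}_{F*}$ is induced by right Kan extension: there is a natural isomorphism $p_{\overline{\mathbf{D}}}^*\,\mathcal{O}_{F*}\cong\mathrm{Ran}_F\,p_{\overline{\mathbf{C}}}^*$ under which the counit $F^*\mathrm{Ran}_F\Rightarrow\mathrm{id}$ at $p_{\overline{\mathbf{C}}}^*A$ corresponds,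 for every $\mathcal{O}_{\overline{\mathbf{C}}}$-algebra $A$, to the image under $p_{\overline{\mathbf{C}}}^*$ of the counit $\mathcal{O}_F^*\mathcal{O}_{F*}A\to A$. -/

import Mathlib

open CategoryTheory MonoidalCategory Limits

universe w v u w₁ w₂

namespace AQFT

/-! ### Combinatorics of blocks -/

theorem finSigmaFinEquiv_lt_iff {m : ℕ} {k : Fin m → ℕ} (x y : (i : Fin m) × Fin (k i)) :
    finSigmaFinEquiv x < finSigmaFinEquiv y ↔
      x.1 < y.1 ∨ (x.1 = y.1 ∧ (x.2 : ℕ) < (y.2 : ℕ)) := by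
  let g : ℕ → ℕ := fun l => if h : l < m then k ⟨l, h⟩ else 0
  have val : ∀ z : (i : Fin m) × Fin (k i),
      (finSigmaFinEquiv z : ℕ) = ∑ l ∈ Finset.range z.1, g l + z.2 := by
    intro z
    rw [finSigmaFinEquiv_apply, ← Fin.sum_univ_eq_sum_range]
    congr 1
    refine Finset.sum_congr rfl fun l _ => ?_
    have hl : (l : ℕ) < m := lt_trans l.2 z.1.2
    simp only [g, hl, dif_pos]
    rfl
  have step : ∀ z z' : (i : Fin m) × Fin (k i), z.1 < z'.1 →
      (finSigmaFinEquiv z : ℕ) < finSigmaFinEquiv z' := by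
    intro z z' h
    rw [val, val]
    have h1 : ∑ l ∈ Finset.range (z.1 + 1), g l ≤ ∑ l ∈ Finset.range z'.1, g l :=
      Finset.sum_le_sum_of_subset (Finset.range_mono (Fin.lt_def.mp h))
    rw [Finset.sum_range_succ] at h1
    have h2 : g z.1 = k z.1 := by simp [g, z.1.2]
    have := z.2.2
    omega
  rw [Fin.lt_def]
  rcases lt_trichotomy x.1 y.1 with h | h | h
  · simp only [h, true_or, iff_true]
    exact step x y h
  · obtain ⟨i, a⟩ := x
    obtain ⟨j, b⟩ := y
    obtain rfl : i = j := h
    rw [val, val]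
    simp
  · have := step y x h
    simp only [h.not_gt, h.ne', false_and, or_false, iff_false, not_lt]
    exact this.le

theorem equiv_ext_of_lt {m n : ℕ} (σ τ : Fin m ≃ Fin n)
    (h : ∀ i j, σ i < σ j ↔ τ i < τ j) : σ = τ := by
  have key : ∀ i j, (σ.symm.trans τ) i ≤ (σ.symm.trans τ) j ↔ i ≤ j := by
    intro i j
    have := h (σ.symm j) (σ.symm i)
    simp only [Equiv.apply_symm_apply] at this
    simp only [Equiv.trans_apply]
    rw [← not_lt, ← not_lt, this]
  let o : Fin n ≃o Fin n := ⟨σ.symm.trans τ, fun {i j} => key i j⟩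
  have ho : o = OrderIso.refl _ := Subsingleton.elim _ _
  ext i
  have : o (σ i) = σ i := by rw [ho]; rfl
  have h2 : o (σ i) = τ i := by simp [o]
  rw [← h2, this]

/-- The permutation `σ(σ₁,…,σₘ)` of `Fin (∑ i, k i)`: it applies `σᵢ` inside the `i`-th block
and moves the `i`-th block to the `σ i`-th place; it is the product of the block permutation
`σ⟨k_{σ⁻¹(1)},…,k_{σ⁻¹(m)}⟩` and of the block sum `σ₁ ⊕ ⋯ ⊕ σₘ`. -/
def blockComp {m : ℕ} (σ : Equiv.Perm (Fin m)) {k : Fin m → ℕ}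
    (s : ∀ i, Equiv.Perm (Fin (k i))) : Equiv.Perm (Fin (∑ i, k i)) :=
  ((((finSigmaFinEquiv (n := k)).symm.trans (Equiv.sigmaCongrRight s)).trans
    (Equiv.sigmaCongrLeft' σ)).trans finSigmaFinEquiv).trans
    (finCongr (Equiv.sum_comp σ.symm k))

theorem blockComp_lt_iff {m : ℕ} (σ : Equiv.Perm (Fin m)) {k : Fin m → ℕ}
    (s : ∀ i, Equiv.Perm (Fin (k i))) (x y : (i : Fin m) × Fin (k i)) :
    blockComp σ s (finSigmaFinEquiv x) < blockComp σ s (finSigmaFinEquiv y) ↔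
      σ x.1 < σ y.1 ∨ (x.1 = y.1 ∧ (s x.1 x.2 : ℕ) < (s y.1 y.2 : ℕ)) := by
  have hval : ∀ z : (i : Fin m) × Fin (k i),
      (((Equiv.sigmaCongrLeft' σ) (Equiv.sigmaCongrRight s z)).2 : ℕ) = s z.1 z.2 := by
    rintro ⟨i, j⟩
    have : ∀ (i' : Fin m) (h : i' = i), HEq (s i' (h ▸ j)) (s i j) := by
      rintro _ rfl; rfl
    have h2 : ∀ (i' : Fin m) (h : i = i') (a : Fin (k i)),
        ((h ▸ a : Fin (k i')) : ℕ) = a := by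
      rintro _ rfl _; rfl
    exact h2 _ _ _
  have hfst : ∀ z : (i : Fin m) × Fin (k i),
      ((Equiv.sigmaCongrLeft' σ) (Equiv.sigmaCongrRight s z)).1 = σ z.1 := by
    rintro ⟨i, j⟩
    rfl
  have := finSigmaFinEquiv_lt_iff ((Equiv.sigmaCongrLeft' σ) (Equiv.sigmaCongrRight s x))
    ((Equiv.sigmaCongrLeft' σ) (Equiv.sigmaCongrRight s y))
  rw [hval, hval, hfst, hfst, σ.injective.eq_iff] at this
  rw [← this]
  simp [blockComp]
  

/-! ### Profiles -/

/-- A `K`-profile: a finite sequence of elements ("colors") of `K`. -/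
structure Profile (K : Type w) where
  len : ℕ
  color : Fin len → K

namespace Profile

variable {K : Type w} {L : Type w₁}

/-- A morphism `c ⟶ c'` of the groupoid of profiles: a bijection of the positions that exhibits
`c'` as the (right) permutation `(c_{σ(1)},…,c_{σ(n)})` of `c`. -/
@[ext]
structure Hom (c c' : Profile K) where
  equiv : Fin c'.len ≃ Fin c.len
  color_eq : ∀ i, c'.color i = c.color (equiv i)

instance : Category (Profile K) where
  Hom := Hom
  id c := ⟨Equiv.refl _, fun _ => rfl⟩
  comp f g := ⟨g.equiv.trans f.equiv, fun i => (g.color_eq i).trans (f.color_eq _)⟩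

theorem hom_ext {c c' : Profile K} (f g : c ⟶ c') (h : f.equiv = g.equiv) : f = g :=
  Hom.ext h

theorem Hom.len_eq {c c' : Profile K} (f : c ⟶ c') : c'.len = c.len := by
  simpa using Fintype.card_congr f.equiv

@[simp] theorem id_equiv (c : Profile K) : Hom.equiv (𝟙 c) = Equiv.refl _ := rfl

@[simp] theorem comp_equiv {a b c : Profile K} (f : a ⟶ b) (g : b ⟶ c) :
    Hom.equiv (f ≫ g) = g.equiv.trans f.equiv := rfl

/-- The profile of length one. -/
def single (t : K) : Profile K := ⟨1, fun _ => t⟩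

/-- The image of a profile under a map of colors. -/
def map (F : K → L) (c : Profile K) : Profile L := ⟨c.len, fun i => F (c.color i)⟩

/-- The image of a morphism of profiles under a map of colors. -/
def mapHom (F : K → L) {c c' : Profile K} (s : c ⟶ c') : c.map F ⟶ c'.map F :=
  ⟨s.equiv, fun i => congrArg F (s.color_eq i)⟩

/-- The profile `cσ = (c_{σ(1)},…,c_{σ(n)})`. -/
def permute (c : Profile K) (σ : Equiv.Perm (Fin c.len)) : Profile K :=
  ⟨c.len, fun i => c.color (σ i)⟩

/-- The morphism `σ : c ⟶ cσ`. -/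
def permuteHom (c : Profile K) (σ : Equiv.Perm (Fin c.len)) : c ⟶ c.permute σ :=
  ⟨σ, fun _ => rfl⟩

/-- The concatenation `b₁ ⊗ ⋯ ⊗ bₘ` of a finite sequence of profiles. -/
def concat {m : ℕ} (b : Fin m → Profile K) : Profile K :=
  ⟨∑ i, (b i).len, fun x => (b (finSigmaFinEquiv.symm x).1).color (finSigmaFinEquiv.symm x).2⟩

/-- The positions of a concatenation: the `j`-th entry of the `i`-th block. -/
def pos {m : ℕ} (b : Fin m → Profile K) : ((i : Fin m) × Fin (b i).len) ≃ Fin (concat b).len :=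
  finSigmaFinEquiv

theorem concat_color {m : ℕ} (b : Fin m → Profile K) (x : Fin (concat b).len) :
    (concat b).color x = (b ((pos b).symm x).1).color ((pos b).symm x).2 := rfl

theorem concat_color_pos {m : ℕ} (b : Fin m → Profile K) (y : (i : Fin m) × Fin (b i).len) :
    (concat b).color (pos b y) = (b y.1).color y.2 :=
  congrArg (fun z : (i : Fin m) × Fin (b i).len => (b z.1).color z.2)
    ((pos b).symm_apply_apply y)

theorem pos_lt_iff {m : ℕ} (b : Fin m → Profile K) (x y : (i : Fin m) × Fin (b i).len) :
    pos b x < pos b y ↔ x.1 < y.1 ∨ (x.1 = y.1 ∧ (x.2 : ℕ) < (y.2 : ℕ)) :=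
  finSigmaFinEquiv_lt_iff x y

/-- The morphism of profiles that permutes blocks by the block permutation `σ⟨k₁,…,kₘ⟩`. -/
def blockPerm {m : ℕ} (b : Fin m → Profile K) (σ : Equiv.Perm (Fin m)) :
    concat b ⟶ concat (fun i => b (σ i)) where
  equiv := ((pos fun i => b (σ i)).symm.trans
    (Equiv.sigmaCongrLeft (β := fun i => Fin (b i).len) σ)).trans (pos b)
  color_eq x := (concat_color_pos b
    (Equiv.sigmaCongrLeft (β := fun i => Fin (b i).len) σ ((pos fun i => b (σ i)).symm x))).symm

/-- The morphism of profiles given by the block sum of a family of morphisms. -/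
def concatHom {m : ℕ} {b b' : Fin m → Profile K} (s : ∀ i, b i ⟶ b' i) :
    concat b ⟶ concat b' where
  equiv := ((pos b').symm.trans (Equiv.sigmaCongrRight fun i => (s i).equiv)).trans (pos b)
  color_eq x := ((s _).color_eq _).trans (concat_color_pos b
    (Equiv.sigmaCongrRight (fun i => (s i).equiv) ((pos b').symm x))).symm

/-- The equality, up to the evident renumbering of positions, of the two ways of concatenating
a two-stage family of profiles. -/
def concatAssoc {m : ℕ} {b : Fin m → Profile K} (c : ∀ i, Fin (b i).len → Profile K) :
    concat (fun x : Fin (concat b).len => c ((pos b).symm x).1 ((pos b).symm x).2) ⟶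
    concat (fun i => concat (c i)) where
  equiv := (((((pos fun x : Fin (concat b).len =>
      c ((pos b).symm x).1 ((pos b).symm x).2).symm.trans (Equiv.sigmaCongrLeft
    (β := fun y : (i : Fin m) × Fin (b i).len => Fin (c y.1 y.2).len)
      (pos b).symm)).trans (Equiv.sigmaAssoc fun i j => Fin (c i j).len)).trans
    (Equiv.sigmaCongrRight fun i => pos (c i))).trans (pos fun i => concat (c i))).symm
  color_eq z := by
    generalize hx : Equiv.symm _ z = x
    rw [Equiv.symm_apply_eq] at hx
    rw [hx]
    refine (concat_color_pos (fun i => concat (c i)) _).trans ?_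
    exact concat_color_pos (c _) _

/-- `c₁ ⊗ ⋯ ⊗ cₙ = c` for the sequence of the length-one profiles of the entries of `c`. -/
def concatSingle (c : Profile K) : c ⟶ concat (fun i => single (c.color i)) where
  equiv := (pos fun i => single (c.color i)).symm.trans
    (Equiv.sigmaUnique (Fin c.len) fun _ => Fin 1)
  color_eq _ := rfl

/-- The concatenation of a sequence that consists of one profile. -/
def singleConcat (c : Profile K) : c ⟶ concat (fun _ : Fin 1 => c) where
  equiv := (pos fun _ : Fin 1 => c).symm.trans (Equiv.uniqueSigma fun _ : Fin 1 => Fin c.len)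
  color_eq x := by
    generalize hy : (pos fun _ : Fin 1 => c).symm x = y
    obtain ⟨i, y⟩ := y
    obtain rfl := Subsingleton.elim i 0
    rw [concat_color, Equiv.trans_apply, hy]
    rfl

end Profile

/-! ### Colored operads with values in sets -/

/-- The inverse of a morphism of the groupoid of profiles. -/
def Profile.inv {K : Type w} {c c' : Profile K} (s : c ⟶ c') : c' ⟶ c where
  equiv := s.equiv.symm
  color_eq i := by rw [s.color_eq, Equiv.apply_symm_apply]

theorem Profile.inv_comp {K : Type w} {c c' : Profile K} (s : c ⟶ c') :
    Profile.inv s ≫ s = 𝟙 _ :=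
  Profile.hom_ext _ _ (Equiv.self_trans_symm _)

open Profile in
/-- A `K`-colored (symmetric) operad with values in sets. `Op c t` is the set of operations
with inputs colored by the profile `c` and with output color `t`. -/
structure Operad (K : Type w) where
  Op : Profile K → K → Type v
  /-- the action of the groupoid of profiles -/
  relabel : ∀ {c c' : Profile K} {t : K}, (c ⟶ c') → Op c t → Op c' t
  /-- the operadic composition `γ` -/
  comp : ∀ {a : Profile K} {t : K} {b : Fin a.len → Profile K},
    Op a t → (∀ i, Op (b i) (a.color i)) → Op (concat b) t
  /-- the operadic units -/
  unit : ∀ t : K, Op (single t) t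
  relabel_id : ∀ {c : Profile K} {t : K} (p : Op c t), relabel (𝟙 c) p = p
  relabel_comp : ∀ {c c' c'' : Profile K} {t : K} (s : c ⟶ c') (s' : c' ⟶ c'') (p : Op c t),
    relabel (s ≫ s') p = relabel s' (relabel s p)
  /-- first equivariance condition -/
  comp_permute : ∀ {a : Profile K} {t : K} {b : Fin a.len → Profile K} (σ : Equiv.Perm (Fin a.len))
    (p : Op a t) (q : ∀ i, Op (b i) (a.color i)),
    comp (a := a.permute σ) (b := fun i => b (σ i)) (relabel (a.permuteHom σ) p)
      (fun i => q (σ i)) = relabel (blockPerm b σ) (comp p q)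
  /-- second equivariance condition -/
  comp_relabel : ∀ {a : Profile K} {t : K} {b b' : Fin a.len → Profile K} (s : ∀ i, b i ⟶ b' i)
    (p : Op a t) (q : ∀ i, Op (b i) (a.color i)),
    comp p (fun i => relabel (s i) (q i)) = relabel (concatHom s) (comp p q)
  comp_assoc : ∀ {a : Profile K} {t : K} {b : Fin a.len → Profile K}
    {c : ∀ i, Fin (b i).len → Profile K} (p : Op a t) (q : ∀ i, Op (b i) (a.color i))
    (r : ∀ i j, Op (c i j) ((b i).color j)),
    relabel (concatAssoc c) (comp (comp p q)
      (fun x => r ((pos b).symm x).1 ((pos b).symm x).2)) = comp p (fun i => comp (q i) (r i))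
  comp_unit : ∀ {a : Profile K} {t : K} (p : Op a t),
    comp p (fun i => unit (a.color i)) = relabel (concatSingle a) p
  unit_comp : ∀ {a : Profile K} {t : K} (p : Op a t),
    comp (a := single t) (unit t) (fun _ => p) = relabel (singleConcat a) p

/-- A morphism from a `K`-colored operad to an `L`-colored operad: a map `F` of colors together
with a morphism of `K`-colored operads from `P` to the pullback of `Q` along `F`. -/
structure Operad.Hom {K : Type w} {L : Type w₁} (P : Operad.{w, v} K) (Q : Operad.{w₁, w₂} L) where
  color : K → L
  app : ∀ {c : Profile K} {t : K}, P.Op c t → Q.Op (c.map color) (color t)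
  app_relabel : ∀ {c c' : Profile K} {t : K} (s : c ⟶ c') (p : P.Op c t),
    app (P.relabel s p) = Q.relabel (Profile.mapHom color s) (app p)
  app_comp : ∀ {a : Profile K} {t : K} {b : Fin a.len → Profile K} (p : P.Op a t)
    (q : ∀ i, P.Op (b i) (a.color i)),
    app (P.comp p q) = Q.comp (a := a.map color) (b := fun i => (b i).map color)
      (app p) (fun i => app (q i))
  app_unit : ∀ t : K, app (P.unit t) = Q.unit (color t)

/-! ### Orthogonal categories -/

/-- An orthogonality relation on a category. -/
structure Orthogonality (C : Type w) [Category.{v} C] where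
  rel : ∀ {c₁ c₂ c : C}, (c₁ ⟶ c) → (c₂ ⟶ c) → Prop
  symm : ∀ {c₁ c₂ c : C} {f₁ : c₁ ⟶ c} {f₂ : c₂ ⟶ c}, rel f₁ f₂ → rel f₂ f₁
  postcomp : ∀ {c₁ c₂ c d : C} {f₁ : c₁ ⟶ c} {f₂ : c₂ ⟶ c} (g : c ⟶ d),
    rel f₁ f₂ → rel (f₁ ≫ g) (f₂ ≫ g)
  precomp : ∀ {b₁ b₂ c₁ c₂ c : C} {f₁ : c₁ ⟶ c} {f₂ : c₂ ⟶ c} (h₁ : b₁ ⟶ c₁) (h₂ : b₂ ⟶ c₂),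
    rel f₁ f₂ → rel (h₁ ≫ f₁) (h₂ ≫ f₂)

section

variable {C : Type w} [Category.{v} C] {D : Type w₁} [Category.{w₂} D]

/-- The pullback `F^*(⊥)` of an orthogonality relation along a functor. -/
def Orthogonality.pullback (perp : Orthogonality D) (F : C ⥤ D) : Orthogonality C where
  rel f₁ f₂ := perp.rel (F.map f₁) (F.map f₂)
  symm h := perp.symm h
  postcomp g h := by
    rw [F.map_comp, F.map_comp]
    exact perp.postcomp _ h
  precomp h₁ h₂ h := by
    rw [F.map_comp, F.map_comp]
    exact perp.precomp _ _ h

/-- Orthogonal functors: functors that preserve the orthogonality relations. -/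
def IsOrthogonal (perpC : Orthogonality C) (perpD : Orthogonality D) (F : C ⥤ D) : Prop :=
  ∀ ⦃c₁ c₂ c : C⦄ (f₁ : c₁ ⟶ c) (f₂ : c₂ ⟶ c), perpC.rel f₁ f₂ → perpD.rel (F.map f₁) (F.map f₂)

theorem isOrthogonal_pullback (perp : Orthogonality D) (F : C ⥤ D) :
    IsOrthogonal (perp.pullback F) perp F := fun _ _ _ _ _ h => h

/-! ### The operad of an orthogonal category -/

/-- The elements `(σ, f)` of the set `Σₙ × C(c, t)`, where `C(c, t)` is the product of the sets
of morphisms `cᵢ ⟶ t`. -/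
@[ext]
structure PreOp (c : Profile C) (t : C) where
  perm : Equiv.Perm (Fin c.len)
  hom : ∀ i, c.color i ⟶ t

namespace PreOp

theorem hom_congr {c : Profile C} {t : C} (p : PreOp c t) {i j : Fin c.len} (h : i = j) :
    p.hom i = eqToHom (congrArg c.color h) ≫ p.hom j := by
  subst h
  simp

/-- `(σ, f) ↦ (σσ', fσ')` -/
def relabel {c c' : Profile C} {t : C} (s : c ⟶ c') (p : PreOp c t) : PreOp c' t where
  perm := (s.equiv.trans p.perm).trans (finCongr s.len_eq.symm)
  hom i := eqToHom (s.color_eq i) ≫ p.hom (s.equiv i)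

theorem relabel_lt_iff {c c' : Profile C} {t : C} (s : c ⟶ c') (p : PreOp c t)
    (i j : Fin c'.len) :
    (p.relabel s).perm i < (p.relabel s).perm j ↔ p.perm (s.equiv i) < p.perm (s.equiv j) :=
  Iff.rfl

/-- `γ((σ, f); (σ₁, g₁), …, (σₘ, gₘ)) = (σ(σ₁,…,σₘ), f(g₁,…,gₘ))` -/
def comp {a : Profile C} {t : C} {b : Fin a.len → Profile C} (p : PreOp a t)
    (q : ∀ i, PreOp (b i) (a.color i)) : PreOp (Profile.concat b) t where
  perm := blockComp p.perm fun i => (q i).perm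
  hom x := (q ((Profile.pos b).symm x).1).hom ((Profile.pos b).symm x).2 ≫
    p.hom ((Profile.pos b).symm x).1

theorem comp_lt_iff {a : Profile C} {t : C} {b : Fin a.len → Profile C} (p : PreOp a t)
    (q : ∀ i, PreOp (b i) (a.color i)) (x y : (i : Fin a.len) × Fin (b i).len) :
    (p.comp q).perm (Profile.pos b x) < (p.comp q).perm (Profile.pos b y) ↔
      p.perm x.1 < p.perm y.1 ∨
        (x.1 = y.1 ∧ ((q x.1).perm x.2 : ℕ) < ((q y.1).perm y.2 : ℕ)) :=
  blockComp_lt_iff _ _ _ _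

/-- `(e, id_t)` -/
def unit (t : C) : PreOp (Profile.single t) t where
  perm := 1
  hom _ := 𝟙 t

/-- `(σ, f) ↦ (σ, F(f))` -/
def mapFunctor (F : C ⥤ D) {c : Profile C} {t : C} (p : PreOp c t) :
    PreOp (c.map F.obj) (F.obj t) where
  perm := p.perm
  hom i := F.map (p.hom i)

theorem mapFunctor_relabel (F : C ⥤ D) {c c' : Profile C} {t : C} (s : c ⟶ c')
    (p : PreOp c t) :
    (p.relabel s).mapFunctor F = (p.mapFunctor F).relabel (Profile.mapHom F.obj s) :=
  PreOp.ext rfl (funext fun i => by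
    simp only [mapFunctor, relabel, F.map_comp, eqToHom_map]
    rfl)

theorem mapFunctor_comp (F : C ⥤ D) {a : Profile C} {t : C} {b : Fin a.len → Profile C}
    (p : PreOp a t) (q : ∀ i, PreOp (b i) (a.color i)) :
    (p.comp q).mapFunctor F = comp (a := a.map F.obj) (b := fun i => (b i).map F.obj)
      (p.mapFunctor F) (fun i => (q i).mapFunctor F) :=
  PreOp.ext rfl (funext fun _ => F.map_comp _ _)

theorem mapFunctor_unit (F : C ⥤ D) (t : C) : (unit t).mapFunctor F = unit (F.obj t) :=
  PreOp.ext rfl (funext fun _ => F.map_id _)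

theorem ext_of_lt {c : Profile C} {t : C} {p p' : PreOp c t} (h : p.hom = p'.hom)
    (h' : ∀ i j, p.perm i < p.perm j ↔ p'.perm i < p'.perm j) : p = p' :=
  PreOp.ext (equiv_ext_of_lt _ _ h') h

theorem relabel_id {c : Profile C} {t : C} (p : PreOp c t) : p.relabel (𝟙 c) = p :=
  ext_of_lt (funext fun _ => Category.id_comp _) fun _ _ => Iff.rfl

theorem relabel_comp {c c' c'' : Profile C} {t : C} (s : c ⟶ c') (s' : c' ⟶ c'')
    (p : PreOp c t) : p.relabel (s ≫ s') = (p.relabel s).relabel s' :=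
  ext_of_lt (funext fun i => by simp [relabel]) fun i j => Iff.rfl

theorem relabel_hom_heq {c c' : Profile C} {t : C} (s : c ⟶ c') (p : PreOp c t)
    (i : Fin c'.len) : HEq ((p.relabel s).hom i) (p.hom (s.equiv i)) :=
  eqToHom_comp_heq _ _

theorem comp_hom_heq {a : Profile C} {t : C} {b : Fin a.len → Profile C} (p : PreOp a t)
    (q : ∀ i, PreOp (b i) (a.color i)) (y : (i : Fin a.len) × Fin (b i).len) :
    HEq ((p.comp q).hom (Profile.pos b y)) ((q y.1).hom y.2 ≫ p.hom y.1) :=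
  congr_arg_heq (fun z : (i : Fin a.len) × Fin (b i).len => (q z.1).hom z.2 ≫ p.hom z.1)
    ((Profile.pos b).symm_apply_apply y)

theorem hom_heq {c : Profile C} {t : C} (p : PreOp c t) {i j : Fin c.len} (h : i = j) :
    HEq (p.hom i) (p.hom j) :=
  congr_arg_heq p.hom h

theorem lt_congr {c : Profile C} {t : C} (p : PreOp c t) {i i' j j' : Fin c.len}
    (hi : i = i') (hj : j = j') : p.perm i < p.perm j ↔ p.perm i' < p.perm j' := by
  rw [hi, hj]

theorem comp_heq {X X' Y Z : C} {f : X ⟶ Y} {f' : X' ⟶ Y} {g g' : Y ⟶ Z} (h : X = X')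
    (hf : HEq f f') (hg : g = g') : HEq (f ≫ g) (f' ≫ g') := by
  subst h hg
  obtain rfl := eq_of_heq hf
  rfl

theorem comp_permute {a : Profile C} {t : C} {b : Fin a.len → Profile C}
    (σ : Equiv.Perm (Fin a.len)) (p : PreOp a t) (q : ∀ i, PreOp (b i) (a.color i)) :
    comp (a := a.permute σ) (b := fun i => b (σ i)) (p.relabel (a.permuteHom σ))
      (fun i => q (σ i)) = (p.comp q).relabel (Profile.blockPerm b σ) := by
  have hpos : ∀ y : (i : Fin a.len) × Fin (b (σ i)).len,
      (Profile.blockPerm b σ).equiv (Profile.pos (fun i => b (σ i)) y) =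
        Profile.pos b ⟨σ y.1, y.2⟩ := fun y => by simp [Profile.blockPerm]
  refine ext_of_lt (funext fun x => ?_) fun x x' => ?_
  · obtain ⟨y, rfl⟩ := (Profile.pos _).surjective x
    refine eq_of_heq ((comp_hom_heq _ _ y).trans ?_)
    refine HEq.trans ?_ (relabel_hom_heq _ _ _).symm
    refine HEq.trans ?_ (hom_heq _ (hpos y)).symm
    refine HEq.trans ?_ (comp_hom_heq _ _ _).symm
    exact comp_heq rfl HEq.rfl (Category.id_comp _)
  · obtain ⟨y, rfl⟩ := (Profile.pos _).surjective x
    obtain ⟨y', rfl⟩ := (Profile.pos _).surjective x'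
    refine (comp_lt_iff _ _ _ _).trans (Iff.trans ?_ (relabel_lt_iff _ _ _ _).symm)
    refine Iff.trans ?_ (lt_congr _ (hpos y) (hpos y')).symm
    refine Iff.trans ?_ (comp_lt_iff p q _ _).symm
    exact or_congr Iff.rfl (and_congr σ.injective.eq_iff.symm Iff.rfl)

theorem comp_relabel {a : Profile C} {t : C} {b b' : Fin a.len → Profile C}
    (s : ∀ i, b i ⟶ b' i) (p : PreOp a t) (q : ∀ i, PreOp (b i) (a.color i)) :
    p.comp (fun i => (q i).relabel (s i)) = (p.comp q).relabel (Profile.concatHom s) := by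
  have hpos : ∀ y : (i : Fin a.len) × Fin (b' i).len,
      (Profile.concatHom s).equiv (Profile.pos b' y) =
        Profile.pos b ⟨y.1, (s y.1).equiv y.2⟩ := fun y => by simp [Profile.concatHom]
  refine ext_of_lt (funext fun x => ?_) fun x x' => ?_
  · obtain ⟨y, rfl⟩ := (Profile.pos _).surjective x
    refine eq_of_heq ((comp_hom_heq _ _ y).trans ?_)
    refine HEq.trans ?_ (relabel_hom_heq _ _ _).symm
    refine HEq.trans ?_ (hom_heq _ (hpos y)).symm
    refine HEq.trans ?_ (comp_hom_heq _ _ _).symm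
    exact comp_heq ((s y.1).color_eq y.2) (relabel_hom_heq _ _ _) rfl
  · obtain ⟨y, rfl⟩ := (Profile.pos _).surjective x
    obtain ⟨y', rfl⟩ := (Profile.pos _).surjective x'
    rw [comp_lt_iff, relabel_lt_iff, hpos, hpos, comp_lt_iff]
    rfl

theorem comp_assoc {a : Profile C} {t : C} {b : Fin a.len → Profile C}
    {c : ∀ i, Fin (b i).len → Profile C} (p : PreOp a t) (q : ∀ i, PreOp (b i) (a.color i))
    (r : ∀ i j, PreOp (c i j) ((b i).color j)) :
    ((p.comp q).comp (fun x => r ((Profile.pos b).symm x).1 ((Profile.pos b).symm x).2)).relabel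
      (Profile.concatAssoc c) = p.comp (fun i => (q i).comp (r i)) := by
  have hpos : ∀ (x : Fin (Profile.concat b).len)
      (k : Fin (c ((Profile.pos b).symm x).1 ((Profile.pos b).symm x).2).len),
      (Profile.concatAssoc c).equiv (Profile.pos (fun i => Profile.concat (c i))
        ⟨((Profile.pos b).symm x).1,
          Profile.pos (c ((Profile.pos b).symm x).1) ⟨((Profile.pos b).symm x).2, k⟩⟩) =
      Profile.pos (fun x : Fin (Profile.concat b).len =>
        c ((Profile.pos b).symm x).1 ((Profile.pos b).symm x).2) ⟨x, k⟩ := by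
    intro x k
    refine (Equiv.symm_apply_eq _).mpr ?_
    simp only [Equiv.trans_apply, Equiv.symm_apply_apply]
    rfl
  have hsurj : ∀ z : Fin (Profile.concat fun i => Profile.concat (c i)).len,
      ∃ (x : Fin (Profile.concat b).len)
        (k : Fin (c ((Profile.pos b).symm x).1 ((Profile.pos b).symm x).2).len),
      z = Profile.pos (fun i => Profile.concat (c i)) ⟨((Profile.pos b).symm x).1,
          Profile.pos (c ((Profile.pos b).symm x).1) ⟨((Profile.pos b).symm x).2, k⟩⟩ := by
    intro z
    obtain ⟨⟨x, k⟩, hw⟩ := (Profile.pos (fun x : Fin (Profile.concat b).len =>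
        c ((Profile.pos b).symm x).1 ((Profile.pos b).symm x).2)).surjective
          ((Profile.concatAssoc c).equiv z)
    exact ⟨x, k, (Profile.concatAssoc c).equiv.injective (hw.symm.trans (hpos x k).symm)⟩
  have key : ∀ (y y' : (i : Fin a.len) × Fin (b i).len) (k : Fin (c y.1 y.2).len)
      (k' : Fin (c y'.1 y'.2).len),
      ((p.perm y.1 < p.perm y'.1 ∨
          y.1 = y'.1 ∧ ((q y.1).perm y.2 : ℕ) < ((q y'.1).perm y'.2 : ℕ)) ∨
        (y = y' ∧ ((r y.1 y.2).perm k : ℕ) < ((r y'.1 y'.2).perm k' : ℕ))) ↔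
      (p.perm y.1 < p.perm y'.1 ∨ (y.1 = y'.1 ∧
        (((q y.1).comp (r y.1)).perm (Profile.pos (c y.1) ⟨y.2, k⟩) : ℕ) <
          (((q y'.1).comp (r y'.1)).perm (Profile.pos (c y'.1) ⟨y'.2, k'⟩) : ℕ))) := by
    rintro ⟨i, j⟩ ⟨i', j'⟩ k k'
    by_cases hi : i = i'
    · subst hi
      have h₃ := comp_lt_iff (q i) (r i) ⟨j, k⟩ ⟨j', k'⟩
      rw [Fin.lt_def, Fin.lt_def] at h₃
      simp [h₃]
    · simp [hi]
  refine ext_of_lt (funext fun z => ?_) fun z z' => ?_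
  · obtain ⟨x, k, rfl⟩ := hsurj z
    refine eq_of_heq ((relabel_hom_heq _ _ _).trans ?_)
    refine (hom_heq _ (hpos x k)).trans ?_
    refine HEq.trans (comp_hom_heq _ _ _) ?_
    refine HEq.trans ?_ (comp_hom_heq _ _ _).symm
    refine HEq.trans ?_ (comp_heq (Profile.concat_color_pos _ _) (comp_hom_heq _ _ _) rfl).symm
    exact heq_of_eq (Category.assoc _ _ _).symm
  · obtain ⟨x, k, rfl⟩ := hsurj z
    obtain ⟨x', k', rfl⟩ := hsurj z'
    refine (relabel_lt_iff _ _ _ _).trans ((lt_congr _ (hpos x k) (hpos x' k')).trans ?_)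
    refine (comp_lt_iff (p.comp q) _ _ _).trans (Iff.trans ?_ (comp_lt_iff p _ _ _).symm)
    have h₁ := comp_lt_iff p q ((Profile.pos b).symm x) ((Profile.pos b).symm x')
    rw [Equiv.apply_symm_apply, Equiv.apply_symm_apply] at h₁
    have h₂ : x = x' ↔ (Profile.pos b).symm x = (Profile.pos b).symm x' :=
      (Profile.pos b).symm.injective.eq_iff.symm
    simp only [h₁, h₂]
    exact key _ _ _ _

theorem comp_unit {a : Profile C} {t : C} (p : PreOp a t) :
    p.comp (fun i => unit (a.color i)) = p.relabel (Profile.concatSingle a) := by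
  have hpos : ∀ y : (i : Fin a.len) × Fin (Profile.single (a.color i)).len,
      (Profile.concatSingle a).equiv (Profile.pos _ y) = y.1 :=
    fun y => by
      exact congrArg Sigma.fst ((Profile.pos _).symm_apply_apply y)
  refine ext_of_lt (funext fun x => ?_) fun x x' => ?_
  · obtain ⟨y, rfl⟩ := (Profile.pos _).surjective x
    refine eq_of_heq ((comp_hom_heq _ _ y).trans ?_)
    refine HEq.trans ?_ (relabel_hom_heq _ _ _).symm
    refine HEq.trans ?_ (hom_heq _ (hpos y)).symm
    exact heq_of_eq (Category.id_comp _)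
  · obtain ⟨⟨i, y⟩, rfl⟩ := (Profile.pos _).surjective x
    obtain ⟨⟨j, y'⟩, rfl⟩ := (Profile.pos _).surjective x'
    rw [comp_lt_iff, relabel_lt_iff, hpos, hpos]
    simp only [or_iff_left_iff_imp, and_imp]
    rintro rfl
    obtain rfl : y = y' := Subsingleton.elim (α := Fin 1) _ _
    intro h
    exact absurd h (lt_irrefl _)

theorem unit_comp {a : Profile C} {t : C} (p : PreOp a t) :
    comp (a := Profile.single t) (unit t) (fun _ => p) = p.relabel (Profile.singleConcat a) := by
  have hpos : ∀ y : (_ : Fin 1) × Fin a.len,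
      (Profile.singleConcat a).equiv (Profile.pos (fun _ => a) y) = y.2 :=
    fun y => by simp [Profile.singleConcat, Equiv.uniqueSigma]
  refine ext_of_lt (funext fun x => ?_) fun x x' => ?_
  · obtain ⟨y, rfl⟩ := (Profile.pos _).surjective x
    refine eq_of_heq ((comp_hom_heq _ _ y).trans ?_)
    refine HEq.trans ?_ (relabel_hom_heq _ _ _).symm
    refine HEq.trans ?_ (hom_heq _ (hpos y)).symm
    exact heq_of_eq (Category.comp_id _)
  · obtain ⟨⟨i, y⟩, rfl⟩ := (Profile.pos _).surjective x
    obtain ⟨⟨j, y'⟩, rfl⟩ := (Profile.pos _).surjective x'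
    obtain rfl : i = j := Subsingleton.elim (α := Fin 1) _ _
    refine (comp_lt_iff (a := Profile.single t) (unit t) (fun _ => p) _ _).trans
      (Iff.trans ?_ (relabel_lt_iff _ _ _ _).symm)
    refine Iff.trans ?_ (lt_congr _ (hpos _) (hpos _)).symm
    exact ⟨fun h => h.elim (fun h => absurd h (lt_irrefl _)) And.right, fun h => Or.inr ⟨rfl, h⟩⟩

theorem perp_congr {perp : Orthogonality C} {c : Profile C} {t : C} (p : PreOp c t)
    {i i' j j' : Fin c.len} (hi : i = i') (hj : j = j') (h : perp.rel (p.hom i') (p.hom j')) :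
    perp.rel (p.hom i) (p.hom j) := by
  subst hi hj
  exact h

/-- One step of the equivalence relation: `σ' = τσ` for a transposition `τ` that
exchanges two morphisms that are adjacent in the sequence `fσ⁻¹` and orthogonal. -/
def Step (perp : Orthogonality C) {c : Profile C} {t : C} (p p' : PreOp c t) : Prop :=
  p'.hom = p.hom ∧ ∃ k l : Fin c.len, (l : ℕ) = k + 1 ∧
    perp.rel (p.hom (p.perm.symm k)) (p.hom (p.perm.symm l)) ∧
    p'.perm = p.perm.trans (Equiv.swap k l)

theorem Step.symm {perp : Orthogonality C} {c : Profile C} {t : C} {p p' : PreOp c t}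
    (h : Step perp p p') : Step perp p' p := by
  obtain ⟨h₁, k, l, hl, hp, h₂⟩ := h
  refine ⟨h₁.symm, k, l, hl, ?_, ?_⟩
  · have e₁ : p'.perm.symm k = p.perm.symm l := by
      rw [h₂, Equiv.symm_trans_apply, Equiv.symm_swap, Equiv.swap_apply_left]
    have e₂ : p'.perm.symm l = p.perm.symm k := by
      rw [h₂, Equiv.symm_trans_apply, Equiv.symm_swap, Equiv.swap_apply_right]
    rw [h₁]
    exact perp_congr p e₁ e₂ (perp.symm hp)
  · rw [h₂]
    ext x
    simp

/-- The equivalence relation `∼_⊥`: `(σ, f) ∼_⊥ (σ', f)` if `σσ'⁻¹ : fσ⁻¹ ⟶ fσ'⁻¹` is a product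
of transpositions of adjacent orthogonal pairs. -/
def Rel (perp : Orthogonality C) {c : Profile C} {t : C} : PreOp c t → PreOp c t → Prop :=
  Relation.ReflTransGen (Step perp)

theorem Rel.symm {perp : Orthogonality C} {c : Profile C} {t : C} {p p' : PreOp c t}
    (h : Rel perp p p') : Rel perp p' p := by
  induction h with
  | refl => exact Relation.ReflTransGen.refl
  | tail _ h ih => exact Relation.ReflTransGen.head h.symm ih

theorem swap_lt_swap_iff {n : ℕ} {k l x y : Fin n} (hl : (l : ℕ) = k + 1)
    (h₁ : ¬ (x = k ∧ y = l)) (h₂ : ¬ (x = l ∧ y = k)) :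
    Equiv.swap k l x < Equiv.swap k l y ↔ x < y := by
  simp only [Equiv.swap_apply_def]
  simp only [Fin.ext_iff] at *
  split_ifs <;> simp only [Fin.lt_def] <;> omega

theorem strictMono_of_succ_lt {n : ℕ} {f : Fin n → Fin n}
    (h : ∀ k l : Fin n, (l : ℕ) = k + 1 → f k < f l) : StrictMono f := by
  cases n with
  | zero => exact fun i => i.elim0
  | succ n => exact Fin.strictMono_iff_lt_succ.mpr fun i => h _ _ (by simp)

/-- Two elements are equivalent iff they only differ in the order of orthogonal pairs. -/
theorem rel_iff (perp : Orthogonality C) {c : Profile C} {t : C} (p p' : PreOp c t) :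
    Rel perp p p' ↔ p.hom = p'.hom ∧ ∀ i j, ¬ perp.rel (p.hom i) (p.hom j) →
      (p.perm i < p.perm j ↔ p'.perm i < p'.perm j) := by
  constructor
  · intro h
    induction h with
    | refl => exact ⟨rfl, fun _ _ _ => Iff.rfl⟩
    | @tail q q' _ h ih =>
      obtain ⟨ih₁, ih₂⟩ := ih
      obtain ⟨h₁, k, l, hl, hp, h₂⟩ := h
      refine ⟨ih₁.trans h₁.symm, fun i j hij => (ih₂ i j hij).trans ?_⟩
      rw [h₂]
      rw [ih₁] at hij
      refine (swap_lt_swap_iff hl ?_ ?_).symm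
      · rintro ⟨rfl, rfl⟩
        exact hij (perp_congr q (Equiv.symm_apply_apply _ _).symm (Equiv.symm_apply_apply _ _).symm
          hp)
      · rintro ⟨rfl, rfl⟩
        exact hij (perp.symm (perp_congr q (Equiv.symm_apply_apply _ _).symm
          (Equiv.symm_apply_apply _ _).symm hp))
  · suffices H : ∀ (n : ℕ) (p : PreOp c t), (Finset.univ.filter fun x : Fin c.len × Fin c.len =>
        p.perm x.1 < p.perm x.2 ∧ p'.perm x.2 < p'.perm x.1).card = n →
        p.hom = p'.hom ∧ (∀ i j, ¬ perp.rel (p.hom i) (p.hom j) →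
          (p.perm i < p.perm j ↔ p'.perm i < p'.perm j)) → Rel perp p p' from H _ p rfl
    intro n
    induction n using Nat.strong_induction_on with
    | _ n IH =>
      rintro p hn ⟨h₁, h₂⟩
      by_cases hd : ∃ k l : Fin c.len, (l : ℕ) = k + 1 ∧
          p'.perm (p.perm.symm l) < p'.perm (p.perm.symm k)
      · obtain ⟨k, l, hl, hd⟩ := hd
        have hperp : perp.rel (p.hom (p.perm.symm k)) (p.hom (p.perm.symm l)) := by
          by_contra hc
          have := (h₂ _ _ hc).mp (by
            simp only [Equiv.apply_symm_apply, Fin.lt_def]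
            omega)
          exact lt_asymm this hd
        let q : PreOp c t := ⟨p.perm.trans (Equiv.swap k l), p.hom⟩
        have hst : Step perp p q := ⟨rfl, k, l, hl, hperp, rfl⟩
        have hq : ∀ i j, ¬ (p.perm i = k ∧ p.perm j = l) → ¬ (p.perm i = l ∧ p.perm j = k) →
            (q.perm i < q.perm j ↔ p.perm i < p.perm j) :=
          fun i j h h' => swap_lt_swap_iff hl h h'
        refine Relation.ReflTransGen.head hst (IH _ ?_ q rfl ⟨h₁, fun i j hij => ?_⟩)
        · rw [← hn]
          apply Finset.card_lt_card
          rw [Finset.ssubset_iff_of_subset]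
          · refine ⟨(p.perm.symm k, p.perm.symm l), ?_, ?_⟩
            · simp only [Finset.mem_filter, Finset.mem_univ, true_and, Equiv.apply_symm_apply]
              exact ⟨by rw [Fin.lt_def]; omega, hd⟩
            · simp only [Finset.mem_filter, Finset.mem_univ, true_and, not_and]
              intro hlt
              simp only [q, Equiv.trans_apply, Equiv.apply_symm_apply, Equiv.swap_apply_left,
                Equiv.swap_apply_right, Fin.lt_def] at hlt
              omega
          · rintro ⟨i, j⟩
            simp only [Finset.mem_filter, Finset.mem_univ, true_and]
            rintro ⟨hi, hj⟩
            refine ⟨?_, hj⟩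
            refine (hq i j ?_ ?_).mp hi
            · rintro ⟨rfl, rfl⟩
              simp only [q, Equiv.trans_apply, Equiv.swap_apply_left,
                Equiv.swap_apply_right, Fin.lt_def] at hi
              omega
            · rintro ⟨rfl, rfl⟩
              simp only [Equiv.symm_apply_apply] at hd
              exact lt_asymm hd hj
        · refine Iff.trans ?_ (h₂ i j hij)
          apply hq
          · rintro ⟨rfl, rfl⟩
            exact hij (perp_congr p (Equiv.symm_apply_apply _ _).symm
              (Equiv.symm_apply_apply _ _).symm hperp)
          · rintro ⟨rfl, rfl⟩
            exact hij (perp.symm (perp_congr p (Equiv.symm_apply_apply _ _).symm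
              (Equiv.symm_apply_apply _ _).symm hperp))
      · have : p = p' := by
          refine PreOp.ext ?_ h₁
          have hmono : StrictMono (p.perm.symm.trans p'.perm) := by
            refine strictMono_of_succ_lt fun k l hl => ?_
            refine lt_of_le_of_ne (not_lt.mp fun hlt => hd ⟨k, l, hl, hlt⟩) fun he => ?_
            have := congrArg Fin.val ((p.perm.symm.trans p'.perm).injective he)
            omega
          refine equiv_ext_of_lt _ _ fun i j => ?_
          have := hmono.lt_iff_lt (a := p.perm i) (b := p.perm j)
          simp only [Equiv.trans_apply, Equiv.symm_apply_apply] at this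
          exact this.symm
        rw [this]
        exact Relation.ReflTransGen.refl

theorem Rel.relabel {perp : Orthogonality C} {c c' : Profile C} {t : C} (s : c ⟶ c')
    {p p' : PreOp c t} (h : Rel perp p p') : Rel perp (p.relabel s) (p'.relabel s) := by
  rw [rel_iff] at h ⊢
  refine ⟨by funext i; simp [PreOp.relabel, h.1], fun i j hij => ?_⟩
  refine h.2 _ _ fun hc => hij ?_
  exact perp.precomp _ _ hc

theorem Rel.comp {perp : Orthogonality C} {a : Profile C} {t : C} {b : Fin a.len → Profile C}
    {p p' : PreOp a t} {q q' : ∀ i, PreOp (b i) (a.color i)} (h : Rel perp p p')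
    (h' : ∀ i, Rel perp (q i) (q' i)) : Rel perp (p.comp q) (p'.comp q') := by
  simp only [rel_iff] at h h' ⊢
  refine ⟨by funext i; simp [PreOp.comp, h.1, (h' _).1], fun i j hij => ?_⟩
  obtain ⟨⟨i, x⟩, rfl⟩ := (Profile.pos b).surjective i
  obtain ⟨⟨j, y⟩, rfl⟩ := (Profile.pos b).surjective j
  have hij' : ¬ perp.rel ((q i).hom x ≫ p.hom i) ((q j).hom y ≫ p.hom j) := fun hc => hij <| by
    have key : ∀ z z' : (i : Fin a.len) × Fin (b i).len, z = ⟨i, x⟩ → z' = ⟨j, y⟩ →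
        perp.rel ((q z.1).hom z.2 ≫ p.hom z.1) ((q z'.1).hom z'.2 ≫ p.hom z'.1) := by
      rintro _ _ rfl rfl
      exact hc
    exact key _ _ ((Profile.pos b).symm_apply_apply _) ((Profile.pos b).symm_apply_apply _)
  rw [comp_lt_iff, comp_lt_iff]
  by_cases hi : i = j
  · subst hi
    have := (h' i).2 x y fun hc => hij' (perp.postcomp _ hc)
    simpa only [lt_irrefl, false_or, true_and, Fin.lt_def] using this
  · have := h.2 i j fun hc => hij' (perp.precomp _ _ hc)
    simpa only [hi, false_and, or_false] using this

theorem Rel.mapFunctor {perpC : Orthogonality C} {perpD : Orthogonality D} {F : C ⥤ D}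
    (hF : IsOrthogonal perpC perpD F) {c : Profile C} {t : C} {p p' : PreOp c t}
    (h : Rel perpC p p') : Rel perpD (p.mapFunctor F) (p'.mapFunctor F) := by
  induction h with
  | refl => exact Relation.ReflTransGen.refl
  | tail _ h ih =>
    refine ih.tail ?_
    obtain ⟨h₁, k, l, hl, hp, h₂⟩ := h
    exact ⟨by simp only [PreOp.mapFunctor, h₁]; rfl, k, l, hl, hF _ _ hp, h₂⟩

/-- The relation `∼_⊥` as a setoid. -/
def setoid (perp : Orthogonality C) (c : Profile C) (t : C) : Setoid (PreOp c t) where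
  r := Rel perp
  iseqv := ⟨fun _ => Relation.ReflTransGen.refl, Rel.symm, Relation.ReflTransGen.trans⟩

end PreOp

open PreOp

/-- The set of operations of `O_C̄`: the quotient of `Σₙ × C(c, t)` by `∼_⊥`. -/
def QFTOp (perp : Orthogonality C) (c : Profile C) (t : C) : Type v :=
  Quotient (PreOp.setoid perp c t)

/-- The class `[σ, f]`. -/
def QFTOp.mk (perp : Orthogonality C) {c : Profile C} {t : C} (p : PreOp c t) :
    QFTOp perp c t := Quotient.mk _ p

theorem QFTOp.sound {perp : Orthogonality C} {c : Profile C} {t : C} {p p' : PreOp c t}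
    (h : Rel perp p p') : QFTOp.mk perp p = QFTOp.mk perp p' := Quotient.sound h

theorem QFTOp.mk_out {perp : Orthogonality C} {c : Profile C} {t : C} (x : QFTOp perp c t) :
    QFTOp.mk perp (Quotient.out x) = x := Quotient.out_eq x

theorem QFTOp.out_mk {perp : Orthogonality C} {c : Profile C} {t : C} (p : PreOp c t) :
    Rel perp (Quotient.out (QFTOp.mk perp p)) p := Quotient.mk_out (s := PreOp.setoid perp c t) p

namespace QFTOp

variable {perp : Orthogonality C}

/-- The action of the groupoid of profiles on classes. -/
def relabel {c c' : Profile C} {t : C} (s : c ⟶ c') : QFTOp perp c t → QFTOp perp c' t :=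
  Quotient.lift (fun p => mk perp (p.relabel s)) fun _ _ h => sound (Rel.relabel s h)

/-- The composition of classes. -/
noncomputable def comp {a : Profile C} {t : C} {b : Fin a.len → Profile C} (p : QFTOp perp a t)
    (q : ∀ i, QFTOp perp (b i) (a.color i)) : QFTOp perp (Profile.concat b) t :=
  mk perp ((Quotient.out p).comp fun i => Quotient.out (q i))

theorem relabel_mk {c c' : Profile C} {t : C} (s : c ⟶ c') (p : PreOp c t) :
    relabel s (mk perp p) = mk perp (p.relabel s) := rfl

theorem comp_mk {a : Profile C} {t : C} {b : Fin a.len → Profile C} (p : PreOp a t)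
    (q : ∀ i, PreOp (b i) (a.color i)) :
    comp (mk perp p) (fun i => mk perp (q i)) = mk perp (p.comp q) :=
  sound (Rel.comp (out_mk p) fun i => out_mk (q i))

theorem exists_rep {c : Profile C} {t : C} (x : QFTOp perp c t) : ∃ p, mk perp p = x :=
  Quotient.exists_rep x

theorem exists_rep_pi {m : ℕ} {b : Fin m → Profile C} {t : Fin m → C}
    (x : ∀ i, QFTOp perp (b i) (t i)) :
    ∃ p : ∀ i, PreOp (b i) (t i), x = fun i => mk perp (p i) :=
  ⟨fun i => Quotient.out (x i), funext fun i => (mk_out (x i)).symm⟩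

end QFTOp

open QFTOp in
/-- The colored operad `O_C̄` of an orthogonal category. -/
noncomputable def qftOperad (perp : Orthogonality C) : Operad.{w, v} C where
  Op := QFTOp perp
  relabel := QFTOp.relabel
  comp := QFTOp.comp
  unit t := QFTOp.mk perp (PreOp.unit t)
  relabel_id x := by
    obtain ⟨p, rfl⟩ := exists_rep x
    exact congrArg _ p.relabel_id
  relabel_comp s s' x := by
    obtain ⟨p, rfl⟩ := exists_rep x
    exact congrArg _ (p.relabel_comp s s')
  comp_permute {a t b} σ x y := by
    obtain ⟨p, rfl⟩ := exists_rep x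
    obtain ⟨q, rfl⟩ := exists_rep_pi y
    refine (comp_mk (a := a.permute σ) _ (fun i => q (σ i))).trans ?_
    rw [comp_mk, relabel_mk]
    exact congrArg _ (p.comp_permute σ q)
  comp_relabel s x y := by
    obtain ⟨p, rfl⟩ := exists_rep x
    obtain ⟨q, rfl⟩ := exists_rep_pi y
    refine (comp_mk _ fun i => (q i).relabel (s i)).trans ?_
    rw [comp_mk, relabel_mk]
    exact congrArg _ (p.comp_relabel s q)
  comp_assoc {a t b c} x y z := by
    obtain ⟨p, rfl⟩ := exists_rep x
    obtain ⟨q, rfl⟩ := exists_rep_pi y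
    obtain ⟨r, rfl⟩ : ∃ r : ∀ i j, PreOp (c i j) ((b i).color j), z = fun i j => mk perp (r i j) :=
      ⟨fun i j => Quotient.out (z i j), funext fun i => funext fun j => (mk_out (z i j)).symm⟩
    rw [comp_mk]
    refine (congrArg _ (comp_mk (p.comp q) fun x =>
      r ((Profile.pos b).symm x).1 ((Profile.pos b).symm x).2)).trans ?_
    simp only [comp_mk]
    exact congrArg _ (p.comp_assoc q r)
  comp_unit x := by
    obtain ⟨p, rfl⟩ := exists_rep x
    rw [comp_mk]
    exact congrArg _ p.comp_unit
  unit_comp x := by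
    obtain ⟨p, rfl⟩ := exists_rep x
    refine (comp_mk (PreOp.unit _) fun _ => p).trans ?_
    exact congrArg _ p.unit_comp

/-- The operad morphism `O_F : O_C̄ ⟶ O_D̄` of an orthogonal functor `F`. -/
def qftOperadMap (perpC : Orthogonality C) (perpD : Orthogonality D) (F : C ⥤ D)
    (hF : IsOrthogonal perpC perpD F) : (qftOperad perpC).Hom (qftOperad perpD) where
  color := F.obj
  app {c t} := Quotient.lift (fun p : PreOp c t => QFTOp.mk perpD (p.mapFunctor F))
    fun _ _ h => QFTOp.sound (Rel.mapFunctor hF h)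
  app_relabel s x := by
    obtain ⟨p, rfl⟩ := QFTOp.exists_rep x
    exact congrArg _ (p.mapFunctor_relabel F s)
  app_comp {a t b} x y := by
    obtain ⟨p, rfl⟩ := QFTOp.exists_rep x
    obtain ⟨q, rfl⟩ := QFTOp.exists_rep_pi y
    refine (congrArg _ (QFTOp.comp_mk p q)).trans ?_
    refine Eq.trans ?_ (QFTOp.comp_mk (perp := perpD) (a := a.map F.obj)
      (b := fun i => (b i).map F.obj) (p.mapFunctor F) fun i => (q i).mapFunctor F).symm
    exact congrArg _ (p.mapFunctor_comp F q)
  app_unit t := congrArg _ (PreOp.mapFunctor_unit F t)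

end

/-! ### Finite tensor products -/

section Tensor

variable {M : Type u} [Category.{v} M] [MonoidalCategory M]

/-- The tensor product `X₁ ⊗ ⋯ ⊗ Xₙ` of a finite sequence of objects. -/
def tens : {n : ℕ} → (Fin n → M) → M
  | 0, _ => 𝟙_ M
  | _ + 1, X => tens (fun i => X (Fin.castSucc i)) ⊗ X (Fin.last _)

/-- The tensor product of a finite sequence of morphisms. -/
def tensMap : {n : ℕ} → {X Y : Fin n → M} → (∀ i, X i ⟶ Y i) → (tens X ⟶ tens Y)
  | 0, _, _, _ => 𝟙 _
  | _ + 1, _, _, φ => tensMap (fun i => φ (Fin.castSucc i)) ⊗ₘ φ (Fin.last _)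

theorem tensMap_id {n : ℕ} (X : Fin n → M) : tensMap (fun i => 𝟙 (X i)) = 𝟙 (tens X) := by
  induction n with
  | zero => rfl
  | succ n ih =>
    simp only [tensMap, ih]
    exact id_tensorHom_id _ _

theorem tensMap_comp {n : ℕ} {X Y Z : Fin n → M} (f : ∀ i, X i ⟶ Y i) (g : ∀ i, Y i ⟶ Z i) :
    tensMap (fun i => f i ≫ g i) = tensMap f ≫ tensMap g := by
  induction n with
  | zero => exact (Category.id_comp _).symm
  | succ n ih =>
    simp only [tensMap, ih]
    exact (tensorHom_comp_tensorHom _ _ _ _).symm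

/-- The tensor product of a finite sequence of morphisms between sequences whose lengths are
only known to be equal. -/
def tensCast : {n N : ℕ} → n = N → (X : Fin n → M) → (Z : Fin N → M) →
    (∀ (i : Fin n) (l : Fin N), (l : ℕ) = i → (X i ⟶ Z l)) → (tens X ⟶ tens Z)
  | 0, 0, _, _, _, _ => 𝟙 _
  | _ + 1, _ + 1, h, _, _, φ =>
    tensCast (Nat.succ.inj h) _ _ (fun i l hl => φ i.castSucc l.castSucc hl) ⊗ₘ
      φ (Fin.last _) (Fin.last _) (Nat.succ.inj h).symm
  | 0, _ + 1, h, _, _, _ => absurd h (Nat.succ_ne_zero _).symm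
  | _ + 1, 0, h, _, _, _ => absurd h (Nat.succ_ne_zero _)

/-- The canonical morphism
`(X₁ ⊗ ⋯ ⊗ Xₙ) ⊗ (Y₁ ⊗ ⋯ ⊗ Yₘ) ⟶ Z₁ ⊗ ⋯ ⊗ Z_N`, `N = n + m`, for given morphisms (in practice,
equalities) `Xᵢ ⟶ Zᵢ` and `Yⱼ ⟶ Z_{n+j}`. -/
def append {n : ℕ} : {m N : ℕ} → n + m = N → (X : Fin n → M) → (Y : Fin m → M) →
    (Z : Fin N → M) → (∀ (i : Fin n) (l : Fin N), (l : ℕ) = i → (X i ⟶ Z l)) →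
    (∀ (j : Fin m) (l : Fin N), (l : ℕ) = n + j → (Y j ⟶ Z l)) → (tens X ⊗ tens Y ⟶ tens Z)
  | 0, _, h, X, _, Z, φ, _ => (ρ_ _).hom ≫ tensCast h X Z φ
  | _ + 1, 0, h, _, _, _, _, _ => absurd h (Nat.succ_ne_zero _)
  | _ + 1, _ + 1, h, X, Y, Z, φ, ψ =>
    (α_ (tens X) _ _).inv ≫
      (append (Nat.succ.inj h) X (fun j => Y j.castSucc) (fun l => Z l.castSucc)
        (fun i l hl => φ i l.castSucc hl) (fun j l hl => ψ j.castSucc l.castSucc hl) ⊗ₘ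
        ψ (Fin.last _) (Fin.last _) (Nat.succ.inj h).symm)

theorem finSigmaFinEquiv_castSucc {m : ℕ} {k : Fin (m + 1) → ℕ} (i : Fin m)
    (j : Fin (k i.castSucc)) :
    (finSigmaFinEquiv (n := k) ⟨i.castSucc, j⟩ : ℕ) =
      finSigmaFinEquiv (n := fun i : Fin m => k i.castSucc) ⟨i, j⟩ := by
  rw [finSigmaFinEquiv_apply, finSigmaFinEquiv_apply]
  rfl

theorem finSigmaFinEquiv_last {m : ℕ} {k : Fin (m + 1) → ℕ} (j : Fin (k (Fin.last m))) :
    (finSigmaFinEquiv (n := k) ⟨Fin.last m, j⟩ : ℕ) = ∑ i : Fin m, k i.castSucc + j := by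
  rw [finSigmaFinEquiv_apply]
  rfl

theorem sum_castSucc {m : ℕ} {k : Fin (m + 1) → ℕ} {N : ℕ} (h : ∑ i, k i = N) :
    ∑ i : Fin m, k i.castSucc = N - k (Fin.last m) := by
  rw [Fin.sum_univ_castSucc] at h
  omega

/-- The canonical morphism
`(X₁₁ ⊗ ⋯ ⊗ X_{1k₁}) ⊗ ⋯ ⊗ (X_{m1} ⊗ ⋯ ⊗ X_{mkₘ}) ⟶ Z₁ ⊗ ⋯ ⊗ Z_N`, `N = k₁ + ⋯ + kₘ`,
for given morphisms (in practice, equalities) from `X_{ij}` to the object `Z_l` at the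
corresponding place. -/
def flat : {m : ℕ} → {k : Fin m → ℕ} → {N : ℕ} → ∑ i, k i = N →
    (X : ∀ i, Fin (k i) → M) → (Z : Fin N → M) →
    (∀ (i : Fin m) (j : Fin (k i)) (l : Fin N), (l : ℕ) = finSigmaFinEquiv (n := k) ⟨i, j⟩ → (X i j ⟶ Z l)) →
    (tens (fun i => tens (X i)) ⟶ tens Z)
  | 0, _, 0, _, _, _, _ => 𝟙 _
  | 0, _, _ + 1, h, _, _, _ => absurd h (by simp)
  | m + 1, k, N, h, X, Z, φ =>
    (flat (k := fun i => k i.castSucc) (N := N - k (Fin.last m)) (sum_castSucc h)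
        (fun i => X i.castSucc) (fun l => Z ⟨l, lt_of_lt_of_le l.2 (Nat.sub_le _ _)⟩)
        (fun i j l hl => φ i.castSucc j _ (hl.trans (finSigmaFinEquiv_castSucc i j).symm))
      ▷ tens (X (Fin.last m))) ≫
    append (by rw [← sum_castSucc h, ← h, Fin.sum_univ_castSucc]) _ _ Z
      (fun i l hl => eqToHom (congrArg Z (Fin.ext hl.symm)))
      (fun j l hl => φ (Fin.last m) j l
        (by rw [hl, finSigmaFinEquiv_last, ← sum_castSucc h]))

section Symmetric

variable [SymmetricCategory M]

theorem castSucc_succAbove_last' {n : ℕ} (i : Fin (n + 1)) :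
    i.castSucc.succAbove (Fin.last n) = Fin.last (n + 1) := by
  rw [Fin.succAbove_of_le_castSucc _ _ (Fin.le_def.mpr (Nat.lt_succ_iff.mp i.2)), Fin.succ_last]

/-- The canonical morphism `X₁ ⊗ ⋯ ⊗ Xₙ₊₁ ⟶ (Y₁ ⊗ ⋯ ⊗ Yₙ) ⊗ Xᵢ` that moves the `i`-th factor to
the end, for given morphisms (in practice, equalities) from the other factors to `Y₁, …, Yₙ`. -/
def extract : {n : ℕ} → (X : Fin (n + 1) → M) → (i : Fin (n + 1)) → (Y : Fin n → M) →
    (∀ j j', j = i.succAbove j' → (X j ⟶ Y j')) → (tens X ⟶ tens Y ⊗ X i)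
  | 0, X, i, _, _ => 𝟙_ M ◁ eqToHom (congrArg X (Fin.ext (Nat.lt_one_iff.mp i.2).symm))
  | n + 1, X, i, Y, φ => Fin.lastCases
      (motive := fun i => (∀ j j', j = i.succAbove j' → (X j ⟶ Y j')) → (tens X ⟶ tens Y ⊗ X i))
      (fun φ => tensMap (fun j => φ j.castSucc j (Fin.succAbove_last_apply j).symm) ▷ _)
      (fun i φ =>
        (extract (fun j => X j.castSucc) i (fun j => Y j.castSucc)
          (fun j j' h => φ j.castSucc j'.castSucc (by
            rw [h, Fin.castSucc_succAbove_castSucc])) ▷ X (Fin.last _)) ≫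
        (α_ _ _ _).hom ≫ (_ ◁ (β_ _ _).hom) ≫ (α_ _ _ _).inv ≫
        ((_ ◁ φ (Fin.last _) (Fin.last _)
          (castSucc_succAbove_last' i).symm) ▷ _))
      i φ

/-- The bijection between the complements of the last position and of its image. -/
def restrictEquiv {m n : ℕ} (e : Fin (m + 1) ≃ Fin (n + 1)) : Fin m ≃ Fin n :=
  ((finSuccAboveEquiv (Fin.last m)).trans
    (e.subtypeEquiv fun a => by rw [e.injective.ne_iff])).trans
    (finSuccAboveEquiv (e (Fin.last m))).symm

theorem succAbove_restrictEquiv {m n : ℕ} (e : Fin (m + 1) ≃ Fin (n + 1)) (i : Fin m) :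
    (e (Fin.last m)).succAbove (restrictEquiv e i) = e i.castSucc := by
  have h := (finSuccAboveEquiv (e (Fin.last m))).apply_symm_apply
    (e.subtypeEquiv (p := fun a => a ≠ Fin.last m) (q := fun a => a ≠ e (Fin.last m))
      (fun a => by rw [e.injective.ne_iff]) (finSuccAboveEquiv (Fin.last m) i))
  exact (congrArg Subtype.val h).trans (congrArg e (Fin.succAbove_last_apply i))

/-- The permutation of tensor factors `X₁ ⊗ ⋯ ⊗ Xₙ ⟶ Y₁ ⊗ ⋯ ⊗ Yₘ` that puts the factor `X_{e(i)}`
at the `i`-th place, for given morphisms (in practice, equalities) `X_{e(i)} ⟶ Yᵢ`. -/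
def permute : {m n : ℕ} → (e : Fin m ≃ Fin n) → (X : Fin n → M) → (Y : Fin m → M) →
    (∀ j i, j = e i → (X j ⟶ Y i)) → (tens X ⟶ tens Y)
  | 0, 0, _, _, _, _ => 𝟙 _
  | 0, _ + 1, e, _, _, _ => (e.symm 0).elim0
  | _ + 1, 0, e, _, _, _ => (e 0).elim0
  | m + 1, _ + 1, e, X, Y, φ =>
    extract X (e (Fin.last m)) (fun j => X ((e (Fin.last m)).succAbove j))
      (fun _ _ h => eqToHom (congrArg X h)) ≫
    (permute (restrictEquiv e) (fun j => X ((e (Fin.last m)).succAbove j))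
        (fun i => Y i.castSucc) (fun j i h => φ _ i.castSucc (by
          rw [h, succAbove_restrictEquiv])) ⊗ₘ φ _ (Fin.last m) rfl)

end Symmetric

end Tensor

/-! ### OperadAlgebras over colored operads -/

section OperadAlgebra

variable {K : Type w} (P : Operad.{w, w₁} K) (M : Type u) [Category.{v} M] [MonoidalCategory M]
  [SymmetricCategory M]

/-- OperadAlgebras with values in a symmetric monoidal category `M` over a colored operad `P` in sets:
a family of objects `A_t` together with structure morphisms
`A_{c₁} ⊗ ⋯ ⊗ A_{cₙ} ⟶ A_t`, one for each operation `p ∈ P(c, t)`, that are compatible with the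
permutation action, the composition and the units of `P`. When `M` is cocomplete and its tensor
product preserves coproducts, a `P(c, t)`-indexed family of such structure morphisms is the same
as one morphism `(∐_{P(c, t)} I) ⊗ A_{c₁} ⊗ ⋯ ⊗ A_{cₙ} ⟶ A_t`, so that these are the algebras over
the operad `P ⊗ I` in `M` obtained from `P` by base change along `(-) ⊗ I : Set ⥤ M`. -/
structure OperadAlgebra where
  obj : K → M
  act : ∀ {c : Profile K} {t : K}, P.Op c t → (tens (fun i => obj (c.color i)) ⟶ obj t)
  act_relabel : ∀ {c c' : Profile K} {t : K} (s : c ⟶ c') (p : P.Op c t),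
    permute s.equiv (fun i => obj (c.color i)) (fun i => obj (c'.color i))
      (fun _ i h => eqToHom (congrArg obj ((congrArg c.color h).trans (s.color_eq i).symm))) ≫
      act (P.relabel s p) = act p
  act_comp : ∀ {a : Profile K} {t : K} {b : Fin a.len → Profile K} (p : P.Op a t)
    (q : ∀ i, P.Op (b i) (a.color i)),
    flat rfl (fun i j => obj ((b i).color j)) (fun l => obj ((Profile.concat b).color l))
      (fun i j _ h => eqToHom (congrArg obj ((Profile.concat_color_pos b ⟨i, j⟩).symm.trans
        (congrArg (Profile.concat b).color (Fin.ext h).symm)))) ≫ act (P.comp p q) =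
    tensMap (fun i => act (q i)) ≫ act p
  act_unit : ∀ t : K, act (P.unit t) = (λ_ (obj t)).hom

namespace OperadAlgebra

variable {P M}

/-- Morphisms of algebras. -/
@[ext]
structure Hom (A B : OperadAlgebra P M) where
  app : ∀ t : K, A.obj t ⟶ B.obj t
  act_app : ∀ {c : Profile K} {t : K} (p : P.Op c t),
    A.act p ≫ app t = tensMap (fun i => app (c.color i)) ≫ B.act p

instance : Category (OperadAlgebra P M) where
  Hom := Hom
  id A := ⟨fun t => 𝟙 (A.obj t), fun p => by
    rw [tensMap_id, Category.comp_id, Category.id_comp]⟩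
  comp f g := ⟨fun t => f.app t ≫ g.app t, fun p => by
    rw [tensMap_comp, ← Category.assoc, f.act_app, Category.assoc, g.act_app, Category.assoc]⟩

@[ext]
theorem hom_ext {A B : OperadAlgebra P M} (f g : A ⟶ B) (h : ∀ t, f.app t = g.app t) : f = g :=
  Hom.ext (funext h)

@[simp] theorem id_app (A : OperadAlgebra P M) (t : K) : Hom.app (𝟙 A) t = 𝟙 (A.obj t) := rfl

@[simp] theorem comp_app {A B E : OperadAlgebra P M} (f : A ⟶ B) (g : B ⟶ E) (t : K) :
    Hom.app (f ≫ g) t = f.app t ≫ g.app t := rfl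

end OperadAlgebra

variable {P} {L : Type w₂} {Q : Operad.{w₂, w₁} L}

/-- The pullback functor from `Q`-algebras to `P`-algebras along an operad morphism `P ⟶ Q`. -/
def Operad.Hom.pullback (F : P.Hom Q) : OperadAlgebra Q M ⥤ OperadAlgebra P M where
  obj A :=
    { obj := fun k => A.obj (F.color k)
      act := fun p => A.act (F.app p)
      act_relabel := fun {c c' t} s p => by
        rw [F.app_relabel]
        exact A.act_relabel (Profile.mapHom F.color s) (F.app p)
      act_comp := fun {a t b} p q => by
        rw [F.app_comp]
        exact A.act_comp (a := a.map F.color) (b := fun i => (b i).map F.color)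
          (F.app p) (fun i => F.app (q i))
      act_unit := fun t => by
        rw [F.app_unit]
        exact A.act_unit (F.color t) }
  map f := ⟨fun t => f.app (F.color t), fun p => f.act_app (F.app p)⟩

end OperadAlgebra

/-! ### The underlying diagram of monoids of an algebra over `O_C̄` -/

section Underlying

variable {C : Type w} [Category.{w₁} C] {perp : Orthogonality C}
  {M : Type u} [Category.{v} M] [MonoidalCategory M] [SymmetricCategory M]

/-- The operation `[e, f]`. -/
def qftOp (perp : Orthogonality C) {c : Profile C} {t : C} (f : ∀ i, c.color i ⟶ t) :
    (qftOperad perp).Op c t := QFTOp.mk perp ⟨1, f⟩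

theorem blockComp_one {m : ℕ} {k : Fin m → ℕ} :
    blockComp (1 : Equiv.Perm (Fin m)) (fun i => (1 : Equiv.Perm (Fin (k i)))) = 1 := by
  refine equiv_ext_of_lt _ _ fun i j => ?_
  obtain ⟨x, rfl⟩ := finSigmaFinEquiv.surjective i
  obtain ⟨y, rfl⟩ := finSigmaFinEquiv.surjective j
  rw [blockComp_lt_iff]
  exact (finSigmaFinEquiv_lt_iff x y).symm

theorem comp_qftOp {a : Profile C} {t : C} {b : Fin a.len → Profile C}
    (f : ∀ i, a.color i ⟶ t) (g : ∀ i j, (b i).color j ⟶ a.color i) :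
    (qftOperad perp).comp (qftOp perp f) (fun i => qftOp perp (g i)) =
      qftOp perp (c := Profile.concat b)
        (fun x => g ((Profile.pos b).symm x).1 ((Profile.pos b).symm x).2 ≫
          f ((Profile.pos b).symm x).1) := by
  refine (QFTOp.comp_mk _ fun i => ⟨1, g i⟩).trans (congrArg _ (PreOp.ext ?_ rfl))
  exact blockComp_one

namespace OperadAlgebra

variable (A : OperadAlgebra (qftOperad perp) M)

/-- The structure morphism `A_c ⊗ ⋯ ⊗ A_c ⟶ A_t` of the operation `[e, (f, …, f)]`. -/
def powAct (n : ℕ) {c t : C} (f : c ⟶ t) : tens (fun _ : Fin n => A.obj c) ⟶ A.obj t :=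
  A.act (c := ⟨n, fun _ => c⟩) (qftOp perp fun _ => f)

theorem powAct_comp {m N : ℕ} (k : Fin m → ℕ) (h : ∑ i, k i = N) {b c t : C} (g : b ⟶ c)
    (f : c ⟶ t) :
    tensMap (fun i => A.powAct (k i) g) ≫ A.powAct m f =
      flat h (fun _ _ => A.obj b) (fun _ => A.obj b) (fun _ _ _ _ => 𝟙 _) ≫
        A.powAct N (g ≫ f) := by
  subst h
  have := A.act_comp (a := ⟨m, fun _ => c⟩) (b := fun i => ⟨k i, fun _ => b⟩)
    (qftOp perp fun _ => f) (fun i => qftOp perp fun _ => g)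
  rw [comp_qftOp] at this
  exact this.symm

theorem powAct_zero {c t : C} (f : c ⟶ t) :
    (A.powAct 0 f : 𝟙_ M ⟶ A.obj t) = A.powAct 0 (𝟙 t) := by
  have key : ∀ (a a' : Fin 0 → C) (h : a = a') (f : ∀ i, a i ⟶ t) (f' : ∀ i, a' i ⟶ t),
      (A.act (c := ⟨0, a⟩) (qftOp perp f) : 𝟙_ M ⟶ A.obj t) =
        A.act (c := ⟨0, a'⟩) (qftOp perp f') := by
    rintro a _ rfl f f'
    rw [show f = f' from funext fun i => i.elim0]
  exact key _ _ (funext fun i => i.elim0) _ _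

theorem powAct_one_id (c : C) : A.powAct 1 (𝟙 c) = (λ_ (A.obj c)).hom := A.act_unit c

/-- `powAct` in arity zero. -/
def act₀ {c t : C} (f : c ⟶ t) : 𝟙_ M ⟶ A.obj t := A.powAct 0 f

/-- `powAct` in arity one. -/
def act₁ {c t : C} (f : c ⟶ t) : 𝟙_ M ⊗ A.obj c ⟶ A.obj t := A.powAct 1 f

/-- `powAct` in arity two. -/
def act₂ {c t : C} (f : c ⟶ t) : (𝟙_ M ⊗ A.obj c) ⊗ A.obj c ⟶ A.obj t := A.powAct 2 f

/-- `powAct` in arity three. -/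
def act₃ {c t : C} (f : c ⟶ t) : ((𝟙_ M ⊗ A.obj c) ⊗ A.obj c) ⊗ A.obj c ⟶ A.obj t := A.powAct 3 f

theorem act₀_eq {c t : C} (f : c ⟶ t) : A.act₀ f = A.act₀ (𝟙 t) := A.powAct_zero f

theorem act₁_id (c : C) : A.act₁ (𝟙 c) = (λ_ (A.obj c)).hom := A.act_unit c

theorem act₁_act₁ {b c t : C} (g : b ⟶ c) (f : c ⟶ t) :
    (𝟙_ M ◁ A.act₁ g) ≫ A.act₁ f = (λ_ _).hom ≫ A.act₁ (g ≫ f) := by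
  have h := A.powAct_comp (m := 1) (N := 1) (fun _ => 1) (by simp) g f
  change (𝟙 (𝟙_ M) ⊗ₘ A.act₁ g) ≫ A.act₁ f = ((𝟙 (𝟙_ M) ▷ (𝟙_ M ⊗ A.obj b)) ≫
    (α_ (𝟙_ M) (𝟙_ M) (A.obj b)).inv ≫ (((ρ_ (𝟙_ M)).hom ≫ 𝟙 _) ⊗ₘ 𝟙 _)) ≫ A.act₁ (g ≫ f) at h
  rw [id_tensorHom] at h
  rw [h]
  congr 1
  monoidal

theorem act₁_act₀ {b c t : C} (g : b ⟶ c) (f : c ⟶ t) :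
    (𝟙_ M ◁ A.act₀ g) ≫ A.act₁ f = (λ_ _).hom ≫ A.act₀ (g ≫ f) := by
  have h := A.powAct_comp (m := 1) (N := 0) (fun _ => 0) (by simp) g f
  change (𝟙 (𝟙_ M) ⊗ₘ A.act₀ g) ≫ A.act₁ f = ((𝟙 (𝟙_ M) ▷ (𝟙_ M)) ≫
    (ρ_ (𝟙_ M)).hom ≫ 𝟙 _) ≫ A.act₀ (g ≫ f) at h
  rw [id_tensorHom] at h
  rw [h]
  congr 1
  monoidal

theorem act₁_act₂ {b c t : C} (g : b ⟶ c) (f : c ⟶ t) :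
    (𝟙_ M ◁ A.act₂ g) ≫ A.act₁ f = (λ_ _).hom ≫ A.act₂ (g ≫ f) := by
  have h := A.powAct_comp (m := 1) (N := 2) (fun _ => 2) (by simp) g f
  change (𝟙 (𝟙_ M) ⊗ₘ A.act₂ g) ≫ A.act₁ f = ((𝟙 (𝟙_ M) ▷ _) ≫
    (α_ (𝟙_ M) (𝟙_ M ⊗ A.obj b) (A.obj b)).inv ≫ (((α_ (𝟙_ M) (𝟙_ M) (A.obj b)).inv ≫
      (((ρ_ (𝟙_ M)).hom ≫ 𝟙 _) ⊗ₘ 𝟙 _)) ⊗ₘ 𝟙 _)) ≫ A.act₂ (g ≫ f) at h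
  rw [id_tensorHom] at h
  rw [h]
  congr 1
  monoidal

theorem act₂_act₁_act₁ {b c t : C} (g : b ⟶ c) (f : c ⟶ t) :
    ((𝟙_ M ◁ A.act₁ g) ⊗ₘ A.act₁ g) ≫ A.act₂ f =
      ((λ_ _).hom ⊗ₘ (λ_ _).hom) ≫ A.act₂ (g ≫ f) := by
  have h := A.powAct_comp (m := 2) (N := 2) (fun _ => 1) (by simp) g f
  change ((𝟙 (𝟙_ M) ⊗ₘ A.act₁ g) ⊗ₘ A.act₁ g) ≫ A.act₂ f =
    ((((𝟙 (𝟙_ M) ▷ (𝟙_ M ⊗ A.obj b)) ≫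
        (α_ (𝟙_ M) (𝟙_ M) (A.obj b)).inv ≫ (((ρ_ (𝟙_ M)).hom ≫ 𝟙 _) ⊗ₘ 𝟙 _)) ▷
      (𝟙_ M ⊗ A.obj b)) ≫ (α_ (𝟙_ M ⊗ A.obj b) (𝟙_ M) (A.obj b)).inv ≫
        (((ρ_ (𝟙_ M ⊗ A.obj b)).hom ≫ (𝟙 _ ⊗ₘ 𝟙 _)) ⊗ₘ 𝟙 _)) ≫ A.act₂ (g ≫ f) at h
  rw [id_tensorHom] at h
  rw [h]
  congr 1
  monoidal

/-- The lengths `k, l` of two blocks. -/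
def pair (k l : ℕ) : Fin 2 → ℕ
  | 0 => k
  | 1 => l

theorem act₂_act₀_act₁ {b c t : C} (g : b ⟶ c) (f : c ⟶ t) :
    ((𝟙_ M ◁ A.act₀ g) ⊗ₘ A.act₁ g) ≫ A.act₂ f =
      ((λ_ _).hom ⊗ₘ (λ_ _).hom) ≫ A.act₁ (g ≫ f) := by
  have h := A.powAct_comp (m := 2) (N := 1) (pair 0 1) rfl g f
  change ((𝟙 (𝟙_ M) ⊗ₘ A.act₀ g) ⊗ₘ A.act₁ g) ≫ A.act₂ f =
    ((((𝟙 (𝟙_ M) ▷ (𝟙_ M)) ≫ (ρ_ (𝟙_ M)).hom ≫ 𝟙 _) ▷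
      (𝟙_ M ⊗ A.obj b)) ≫ (α_ (𝟙_ M) (𝟙_ M) (A.obj b)).inv ≫
        (((ρ_ (𝟙_ M)).hom ≫ 𝟙 _) ⊗ₘ 𝟙 _)) ≫ A.act₁ (g ≫ f) at h
  rw [id_tensorHom] at h
  rw [h]
  congr 1
  monoidal

theorem act₂_act₁_act₀ {b c t : C} (g : b ⟶ c) (f : c ⟶ t) :
    ((𝟙_ M ◁ A.act₁ g) ⊗ₘ A.act₀ g) ≫ A.act₂ f =
      (ρ_ _).hom ≫ (λ_ _).hom ≫ A.act₁ (g ≫ f) := by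
  have h := A.powAct_comp (m := 2) (N := 1) (pair 1 0) rfl g f
  change ((𝟙 (𝟙_ M) ⊗ₘ A.act₁ g) ⊗ₘ A.act₀ g) ≫ A.act₂ f =
    ((((𝟙 (𝟙_ M) ▷ (𝟙_ M ⊗ A.obj b)) ≫
        (α_ (𝟙_ M) (𝟙_ M) (A.obj b)).inv ≫ (((ρ_ (𝟙_ M)).hom ≫ 𝟙 _) ⊗ₘ 𝟙 _)) ▷ (𝟙_ M)) ≫
      (ρ_ (𝟙_ M ⊗ A.obj b)).hom ≫ (𝟙 _ ⊗ₘ 𝟙 _)) ≫ A.act₁ (g ≫ f) at h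
  rw [id_tensorHom] at h
  rw [h, ← Category.assoc (ρ_ _).hom]
  congr 1
  monoidal

theorem act₂_act₂_act₁ {b c t : C} (g : b ⟶ c) (f : c ⟶ t) :
    ((𝟙_ M ◁ A.act₂ g) ⊗ₘ A.act₁ g) ≫ A.act₂ f =
      ((λ_ _).hom ⊗ₘ (λ_ _).hom) ≫ A.act₃ (g ≫ f) := by
  have h := A.powAct_comp (m := 2) (N := 3) (pair 2 1) rfl g f
  change ((𝟙 (𝟙_ M) ⊗ₘ A.act₂ g) ⊗ₘ A.act₁ g) ≫ A.act₂ f =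
    ((((𝟙 (𝟙_ M) ▷ _) ≫
    (α_ (𝟙_ M) (𝟙_ M ⊗ A.obj b) (A.obj b)).inv ≫ (((α_ (𝟙_ M) (𝟙_ M) (A.obj b)).inv ≫
      (((ρ_ (𝟙_ M)).hom ≫ 𝟙 _) ⊗ₘ 𝟙 _)) ⊗ₘ 𝟙 _)) ▷
      (𝟙_ M ⊗ A.obj b)) ≫ (α_ ((𝟙_ M ⊗ A.obj b) ⊗ A.obj b) (𝟙_ M) (A.obj b)).inv ≫
        (((ρ_ ((𝟙_ M ⊗ A.obj b) ⊗ A.obj b)).hom ≫ ((𝟙 _ ⊗ₘ 𝟙 _) ⊗ₘ 𝟙 _)) ⊗ₘ 𝟙 _)) ≫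
          A.act₃ (g ≫ f) at h
  rw [id_tensorHom] at h
  rw [h]
  congr 1
  monoidal

theorem act₂_act₁_act₂ {b c t : C} (g : b ⟶ c) (f : c ⟶ t) :
    ((𝟙_ M ◁ A.act₁ g) ⊗ₘ A.act₂ g) ≫ A.act₂ f =
      ((λ_ _).hom ⊗ₘ ((λ_ _).hom ▷ _)) ≫ (α_ _ _ _).inv ≫ A.act₃ (g ≫ f) := by
  have h := A.powAct_comp (m := 2) (N := 3) (pair 1 2) rfl g f
  change ((𝟙 (𝟙_ M) ⊗ₘ A.act₁ g) ⊗ₘ A.act₂ g) ≫ A.act₂ f =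
    ((((𝟙 (𝟙_ M) ▷ (𝟙_ M ⊗ A.obj b)) ≫
        (α_ (𝟙_ M) (𝟙_ M) (A.obj b)).inv ≫ (((ρ_ (𝟙_ M)).hom ≫ 𝟙 _) ⊗ₘ 𝟙 _)) ▷
          ((𝟙_ M ⊗ A.obj b) ⊗ A.obj b)) ≫
      (α_ (𝟙_ M ⊗ A.obj b) (𝟙_ M ⊗ A.obj b) (A.obj b)).inv ≫
        (((α_ (𝟙_ M ⊗ A.obj b) (𝟙_ M) (A.obj b)).inv ≫
        (((ρ_ (𝟙_ M ⊗ A.obj b)).hom ≫ (𝟙 _ ⊗ₘ 𝟙 _)) ⊗ₘ 𝟙 _)) ⊗ₘ 𝟙 _)) ≫ A.act₃ (g ≫ f) at h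
  rw [id_tensorHom] at h
  rw [h, ← Category.assoc (_ ⊗ₘ _) (α_ _ _ _).inv]
  congr 1
  monoidal

/-- The unit of the monoid `A_c`, given by the operation of arity zero. -/
def one (c : C) : 𝟙_ M ⟶ A.obj c := A.act₀ (𝟙 c)

/-- The multiplication of the monoid `A_c`, given by the operation `[e, (id, id)]`. -/
def mul (c : C) : A.obj c ⊗ A.obj c ⟶ A.obj c :=
  ((λ_ (A.obj c)).inv ▷ A.obj c) ≫ A.act₂ (𝟙 c)

/-- The morphism `A_c ⟶ A_t` given by the operation `[e, f]` of a morphism `f : c ⟶ t`. -/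
def trans {c t : C} (f : c ⟶ t) : A.obj c ⟶ A.obj t := (λ_ (A.obj c)).inv ≫ A.act₁ f

theorem act₁_eq {c t : C} (f : c ⟶ t) : A.act₁ f = (λ_ _).hom ≫ A.trans f := by
  simp [trans]

theorem act₂_eq_mul (c : C) : A.act₂ (𝟙 c) = ((λ_ _).hom ▷ _) ≫ A.mul c := by
  rw [mul, ← comp_whiskerRight_assoc, Iso.hom_inv_id, id_whiskerRight, Category.id_comp]

theorem trans_id (c : C) : A.trans (𝟙 c) = 𝟙 _ := by
  simp [trans, act₁_id]

theorem trans_comp {b c t : C} (g : b ⟶ c) (f : c ⟶ t) :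
    A.trans (g ≫ f) = A.trans g ≫ A.trans f := by
  have h := A.act₁_act₁ g f
  rw [act₁_eq, act₁_eq, act₁_eq, leftUnitor_naturality_assoc, cancel_epi, Category.assoc,
    cancel_epi] at h
  exact h.symm

theorem one_trans {c t : C} (f : c ⟶ t) : A.one c ≫ A.trans f = A.one t := by
  have h := A.act₁_act₀ (𝟙 c) f
  rw [act₁_eq, leftUnitor_naturality_assoc, cancel_epi, act₀_eq A (𝟙 c ≫ f)] at h
  exact h

theorem act₂_eq_mul_trans {c t : C} (f : c ⟶ t) :
    A.act₂ f = ((λ_ _).hom ▷ _) ≫ A.mul c ≫ A.trans f := by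
  have h := A.act₁_act₂ (𝟙 c) f
  rw [act₁_eq, leftUnitor_naturality_assoc, cancel_epi, Category.id_comp, act₂_eq_mul,
    Category.assoc] at h
  exact h.symm

theorem act₂_eq_trans_mul {c t : C} (f : c ⟶ t) :
    A.act₂ f = ((λ_ _).hom ▷ _) ≫ (A.trans f ⊗ₘ A.trans f) ≫ A.mul t := by
  have h := A.act₂_act₁_act₁ f (𝟙 t)
  rw [Category.comp_id, act₂_eq_mul, act₁_eq] at h
  rw [← cancel_epi ((λ_ (𝟙_ M ⊗ A.obj c)).hom ⊗ₘ (λ_ (A.obj c)).hom), ← h, ← Category.assoc,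
    ← Category.assoc, ← Category.assoc]
  congr 1
  monoidal

theorem mul_trans {c t : C} (f : c ⟶ t) :
    A.mul c ≫ A.trans f = (A.trans f ⊗ₘ A.trans f) ≫ A.mul t := by
  have h := (A.act₂_eq_mul_trans f).symm.trans (A.act₂_eq_trans_mul f)
  rwa [cancel_epi] at h

theorem one_mul (c : C) : (A.one c ▷ A.obj c) ≫ A.mul c = (λ_ (A.obj c)).hom := by
  have h := A.act₂_act₀_act₁ (𝟙 c) (𝟙 c)
  rw [Category.comp_id, act₂_eq_mul, act₁_id] at h
  rw [← cancel_epi ((λ_ (𝟙_ M)).hom ⊗ₘ (λ_ (A.obj c)).hom), ← h, one, ← Category.assoc,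
    ← Category.assoc]
  congr 1
  monoidal

theorem mul_one (c : C) : (A.obj c ◁ A.one c) ≫ A.mul c = (ρ_ (A.obj c)).hom := by
  have h := A.act₂_act₁_act₀ (𝟙 c) (𝟙 c)
  rw [Category.comp_id, act₂_eq_mul, act₁_id] at h
  refine (cancel_epi (((λ_ (𝟙_ M ⊗ A.obj c)).hom ≫ (λ_ (A.obj c)).hom) ▷ 𝟙_ M)).mp ?_
  refine Eq.trans ?_ (h.trans ?_)
  · rw [one, ← Category.assoc, ← Category.assoc]
    congr 1
    monoidal
  · monoidal

theorem mul_assoc (c : C) : (A.mul c ▷ A.obj c) ≫ A.mul c =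
    (α_ (A.obj c) (A.obj c) (A.obj c)).hom ≫ (A.obj c ◁ A.mul c) ≫ A.mul c := by
  have h := A.act₂_act₂_act₁ (𝟙 c) (𝟙 c)
  have h' := A.act₂_act₁_act₂ (𝟙 c) (𝟙 c)
  rw [Category.comp_id, act₁_id, act₂_eq_mul] at h h'
  have e : A.act₃ (𝟙 c) = (((λ_ _).hom ▷ _) ▷ _) ≫ (A.mul c ▷ A.obj c) ≫ A.mul c := by
    rw [← cancel_epi ((λ_ _).hom ⊗ₘ (λ_ _).hom), ← h, ← Category.assoc, ← Category.assoc,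
      ← Category.assoc]
    congr 1
    monoidal
  have e' : A.act₃ (𝟙 c) = (((λ_ _).hom ▷ _) ▷ _) ≫ (α_ (A.obj c) (A.obj c) (A.obj c)).hom ≫
      (A.obj c ◁ A.mul c) ≫ A.mul c := by
    rw [← cancel_epi (α_ _ _ _).inv, ← cancel_epi ((λ_ _).hom ⊗ₘ ((λ_ _).hom ▷ _)), ← h',
      ← Category.assoc, ← Category.assoc, ← Category.assoc, ← Category.assoc, ← Category.assoc]
    congr 1
    monoidal
  have := e.symm.trans e'
  rwa [cancel_epi] at this

instance monObj (c : C) : MonObj (A.obj c) where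
  one := A.one c
  mul := A.mul c
  one_mul := A.one_mul c
  mul_one := A.mul_one c
  mul_assoc := A.mul_assoc c

instance isMonHom_trans {c t : C} (f : c ⟶ t) : IsMonHom (A.trans f) where
  one_hom := A.one_trans f
  mul_hom := A.mul_trans f

/-- The underlying functor of an algebra, with values in monoids. -/
def toMon : C ⥤ Mon M where
  obj c := Mon.mk (A.obj c)
  map f := Mon.Hom.mk (A.trans f)
  map_id c := by
    ext
    exact A.trans_id c
  map_comp f g := by
    ext
    exact A.trans_comp f g

variable {A} {B : OperadAlgebra (qftOperad perp) M}

theorem app_one (g : A ⟶ B) (c : C) : A.one c ≫ g.app c = B.one c :=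
  (g.act_app (c := ⟨0, fun _ => c⟩) _).trans (Category.id_comp _)

theorem app_act₁ (g : A ⟶ B) {c t : C} (f : c ⟶ t) :
    A.act₁ f ≫ g.app t = (𝟙_ M ◁ g.app c) ≫ B.act₁ f := by
  rw [← id_tensorHom]
  exact g.act_app (c := ⟨1, fun _ => c⟩) _

theorem app_act₂ (g : A ⟶ B) {c t : C} (f : c ⟶ t) :
    A.act₂ f ≫ g.app t = ((𝟙_ M ◁ g.app c) ⊗ₘ g.app c) ≫ B.act₂ f := by
  rw [← id_tensorHom]
  exact g.act_app (c := ⟨2, fun _ => c⟩) _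

theorem app_trans (g : A ⟶ B) {c t : C} (f : c ⟶ t) :
    A.trans f ≫ g.app t = g.app c ≫ B.trans f := by
  rw [trans, trans, Category.assoc, app_act₁, leftUnitor_inv_naturality_assoc]

theorem app_mul (g : A ⟶ B) (c : C) :
    A.mul c ≫ g.app c = (g.app c ⊗ₘ g.app c) ≫ B.mul c := by
  rw [mul, mul, Category.assoc, app_act₂, ← Category.assoc, ← Category.assoc]
  congr 1
  monoidal

instance isMonHom_app (g : A ⟶ B) (c : C) : IsMonHom (g.app c) where
  one_hom := app_one g c
  mul_hom := app_mul g c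

end OperadAlgebra

variable (perp M)

/-- The functor from algebras over `O_C̄` to functors from `C` to monoids in `M` that forgets the
compatibility with the orthogonality relation. -/
def underlying : OperadAlgebra (qftOperad perp) M ⥤ (C ⥤ Mon M) where
  obj A := A.toMon
  map {A B} g :=
    { app := fun c => (Mon.Hom.mk (g.app c) : Mon.mk (A.obj c) ⟶ Mon.mk (B.obj c))
      naturality := fun c t f => by
        ext
        exact OperadAlgebra.app_trans g f }

variable {D : Type w₂} [Category.{w₁} D] {perpD : Orthogonality D}

namespace OperadAlgebra

variable {perp M} (F : C ⥤ D) (hF : IsOrthogonal perp perpD F) (A : OperadAlgebra (qftOperad perpD) M)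

theorem pullback_powAct (n : ℕ) {c t : C} (f : c ⟶ t) :
    (((qftOperadMap perp perpD F hF).pullback M).obj A).powAct n f = A.powAct n (F.map f) :=
  rfl

theorem pullback_one (c : C) :
    (((qftOperadMap perp perpD F hF).pullback M).obj A).one c = A.one (F.obj c) :=
  congrArg (fun f => A.act₀ f) (F.map_id c)

theorem pullback_mul (c : C) :
    (((qftOperadMap perp perpD F hF).pullback M).obj A).mul c = A.mul (F.obj c) :=
  congrArg (fun f => ((λ_ (A.obj (F.obj c))).inv ▷ A.obj (F.obj c)) ≫ A.act₂ f) (F.map_id c)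

theorem pullback_trans {c t : C} (f : c ⟶ t) :
    (((qftOperadMap perp perpD F hF).pullback M).obj A).trans f = A.trans (F.map f) :=
  rfl

/-- The two monoid structures on the object `A_{F(c)}` are the same. -/
noncomputable def monIso (c : C) :
    (((qftOperadMap perp perpD F hF).pullback M).obj A).toMon.obj c ≅ A.toMon.obj (F.obj c) :=
  Mon.mkIso (Iso.refl (A.obj (F.obj c)))
    ((Category.comp_id _).trans (pullback_one F hF A c))
    ((Category.comp_id _).trans ((pullback_mul F hF A c).trans
      ((congrArg (fun f => f ≫ A.mul (F.obj c)) (id_tensorHom_id _ _)).trans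
        (Category.id_comp _)).symm))

end OperadAlgebra

/-- The underlying functors are compatible with pullbacks: `p_C^* O_F^* ≅ F^* p_D^*`, where
`F^*` is the precomposition with `F`. All components are identities. -/
noncomputable def underlyingPullback (F : C ⥤ D) (hF : IsOrthogonal perp perpD F) :
    (qftOperadMap perp perpD F hF).pullback M ⋙ underlying perp M ≅
      underlying perpD M ⋙ (Functor.whiskeringLeft C D (Mon M)).obj F :=
  NatIso.ofComponents
    (fun A => NatIso.ofComponents (fun c => OperadAlgebra.monIso F hF A c) fun {c t} f => by
      ext
      exact (Category.comp_id _).trans (Category.id_comp _).symm)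
    fun {A B} g => by
      ext c
      exact (Category.comp_id _).trans (Category.id_comp _).symm

end Underlying

/-! ### Categories fibered in groupoids -/

/-- `F : C ⥤ D` exhibits `C` as a category fibered in groupoids over `D`: every morphism
`g : d ⟶ F c'` has a lift with target `c'`, and every morphism of `C` is (strongly) cartesian, that
is, for all `f : c ⟶ c'`, `f'' : c'' ⟶ c'` and `g : F c'' ⟶ F c` with `F f'' = g ≫ F f` there is a
unique `h : c'' ⟶ c` with `F h = g` and `h ≫ f = f''`. -/
structure IsFiberedInGroupoids {C : Type w} [Category.{v} C] {D : Type w₁} [Category.{w₂} D]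
    (F : C ⥤ D) : Prop where
  exists_lift : ∀ (c' : C) {d : D} (g : d ⟶ F.obj c'), ∃ (c : C) (e : F.obj c = d) (f : c ⟶ c'), F.map f = eqToHom e ≫ g
  existsUnique_lift : ∀ {c c' c'' : C} (f : c ⟶ c') (f'' : c'' ⟶ c') (g : F.obj c'' ⟶ F.obj c),
    F.map f'' = g ≫ F.map f → ∃! h : c'' ⟶ c, F.map h = g ∧ h ≫ f = f''

end AQFT

namespace AQFT

/-! ### Naturality of the canonical morphisms between finite tensor products -/

section TensorNaturality

variable {M : Type u} [Category.{v} M]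

/-! On underlying objects the right Kan extension is `(Ran A)_d = lim A_c`, the limit running over
all `k : d ⟶ F c`, with projections `proj k`. A morphism into it is determined by its composites
with the projections, so every structure on it is defined, and every identity about it checked, one
projection at a time.

For an operation `[σ, f]` with `fᵢ : dᵢ ⟶ t`, and for `g : t ⟶ F c`, the composite of its action
with `proj g` is forced: project the `i`-th factor along `fᵢ ≫ g` to `A_c`, then multiply in `A_c`
in the order given by `σ`. By associativity of composition and functoriality of `A` these maps form
a cone in `g`. What needs an argument is independence of the representative `(σ, f)`, and this is
where the fibration enters. Each `fᵢ ≫ g` lifts to some `lᵢ : bᵢ ⟶ c` in `C`, so `proj (fᵢ ≫ g)`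
factors through `A_{bᵢ}` as a projection followed by the action of `lᵢ`. If `fᵢ ⊥ fⱼ`, then `fᵢ ≫ g
⊥ fⱼ ≫ g`, hence `lᵢ` and `lⱼ` are orthogonal for the pullback relation, and the commutativity
already present in `A` absorbs the exchange of the two factors (`tensMap_proj_actHom_congr`,
`exists_act`).

After projection to `A_c`, the axioms for the new algebra become the axioms for `A` at profiles that
are constant at `c` and operations whose morphisms are all identities. The passage between the two
is the naturality of the canonical maps that permute and flatten tensor products
(`permute_naturality`, `flat_naturality`).

The counit is the projection at `𝟙 (F c)`. A morphism `φ` from the pullback of `B` to `A`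
corresponds to the morphism from `B` whose composite with `proj k` is `B.trans k ≫ φ_c`. Since
projections of limits of monoids are monoid morphisms, the unit and multiplication obtained this way
agree with those of `F.ran`, so the comparison isomorphism can be taken to be the identity on
underlying objects. -/

theorem comp_square {X Y Z X' Y' Z' : M} {f : X ⟶ Y} {g : Y ⟶ Z} {f' : X' ⟶ Y'} {g' : Y' ⟶ Z'}
    {a : X ⟶ X'} {b : Y ⟶ Y'} {c : Z ⟶ Z'} (h : f ≫ b = a ≫ f') (h' : g ≫ c = b ≫ g') :
    (f ≫ g) ≫ c = a ≫ f' ≫ g' := by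
  rw [Category.assoc, h', reassoc_of% h]

variable [MonoidalCategory M]

theorem tensor_square {X Y X' Y' Z W Z' W' : M} {f : X ⟶ Y} {f' : X' ⟶ Y'} {a : X ⟶ X'}
    {b : Y ⟶ Y'} {g : Z ⟶ W} {g' : Z' ⟶ W'} {c : Z ⟶ Z'} {d : W ⟶ W'}
    (h : f ≫ b = a ≫ f') (h' : g ≫ d = c ≫ g') :
    (f ⊗ₘ g) ≫ (b ⊗ₘ d) = (a ⊗ₘ c) ≫ (f' ⊗ₘ g') := by
  rw [tensorHom_comp_tensorHom, tensorHom_comp_tensorHom, h, h']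

theorem whiskerRight_square {X Y X' Y' Z Z' : M} {f : X ⟶ Y} {f' : X' ⟶ Y'} {a : X ⟶ X'}
    {b : Y ⟶ Y'} (c : Z ⟶ Z') (h : f ≫ b = a ≫ f') :
    (f ▷ Z) ≫ (b ⊗ₘ c) = (a ⊗ₘ c) ≫ (f' ▷ Z') := by
  rw [← tensorHom_id, ← tensorHom_id]
  exact tensor_square h ((Category.id_comp c).trans (Category.comp_id c).symm)

theorem whiskerLeft_square {X Y X' Y' Z Z' : M} {f : X ⟶ Y} {f' : X' ⟶ Y'} {a : X ⟶ X'}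
    {b : Y ⟶ Y'} (c : Z ⟶ Z') (h : f ≫ b = a ≫ f') :
    (Z ◁ f) ≫ (c ⊗ₘ b) = (c ⊗ₘ a) ≫ (Z' ◁ f') := by
  rw [← id_tensorHom, ← id_tensorHom]
  exact tensor_square ((Category.id_comp c).trans (Category.comp_id c).symm) h

theorem isIso_tensMap {n : ℕ} {X Y : Fin n → M} (φ : ∀ i, X i ⟶ Y i) [∀ i, IsIso (φ i)] :
    IsIso (tensMap φ) :=
  ⟨tensMap fun i => inv (φ i), by rw [← tensMap_comp]; simp [tensMap_id],
    by rw [← tensMap_comp]; simp [tensMap_id]⟩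

/-- In this family of naturality statements the comparison maps `φ`, `φ'` are arbitrary and only
required to commute with the vertical maps. This generality is used later: one row consists of
transports between equal colors, the other of identities of a single object `A_c`, and the columns
are limit projections. -/
theorem tensCast_naturality : {n N : ℕ} → (h : n = N) → {X X' : Fin n → M} → {Z Z' : Fin N → M} →
    (φ : ∀ (i : Fin n) (l : Fin N), (l : ℕ) = i → (X i ⟶ Z l)) →
    (φ' : ∀ (i : Fin n) (l : Fin N), (l : ℕ) = i → (X' i ⟶ Z' l)) →
    (α : ∀ i, X i ⟶ X' i) → (β : ∀ l, Z l ⟶ Z' l) →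
    (∀ i l hl, φ i l hl ≫ β l = α i ≫ φ' i l hl) →
    tensCast h X Z φ ≫ tensMap β = tensMap α ≫ tensCast h X' Z' φ'
  | 0, 0, _, _, _, _, _, _, _, _, _, _ => rfl
  | _ + 1, _ + 1, h, _, _, _, _, φ, φ', α, β, w =>
    tensor_square (tensCast_naturality (Nat.succ.inj h)
      (fun i l hl => φ i.castSucc l.castSucc hl) (fun i l hl => φ' i.castSucc l.castSucc hl)
      (fun i => α i.castSucc) (fun l => β l.castSucc) fun _ _ _ => w _ _ _) (w _ _ _)
  | 0, _ + 1, h, _, _, _, _, _, _, _, _, _ => absurd h (Nat.succ_ne_zero _).symm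
  | _ + 1, 0, h, _, _, _, _, _, _, _, _, _ => absurd h (Nat.succ_ne_zero _)

theorem append_naturality {n : ℕ} : {m N : ℕ} → (h : n + m = N) → {X X' : Fin n → M} →
    {Y Y' : Fin m → M} → {Z Z' : Fin N → M} →
    (φ : ∀ (i : Fin n) (l : Fin N), (l : ℕ) = i → (X i ⟶ Z l)) →
    (φ' : ∀ (i : Fin n) (l : Fin N), (l : ℕ) = i → (X' i ⟶ Z' l)) →
    (ψ : ∀ (j : Fin m) (l : Fin N), (l : ℕ) = n + j → (Y j ⟶ Z l)) →
    (ψ' : ∀ (j : Fin m) (l : Fin N), (l : ℕ) = n + j → (Y' j ⟶ Z' l)) →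
    (α : ∀ i, X i ⟶ X' i) → (γ : ∀ j, Y j ⟶ Y' j) → (β : ∀ l, Z l ⟶ Z' l) →
    (∀ i l hl, φ i l hl ≫ β l = α i ≫ φ' i l hl) →
    (∀ j l hl, ψ j l hl ≫ β l = γ j ≫ ψ' j l hl) →
    append h X Y Z φ ψ ≫ tensMap β = (tensMap α ⊗ₘ tensMap γ) ≫ append h X' Y' Z' φ' ψ'
  | 0, _, h, _, _, _, _, _, _, φ, φ', _, _, α, _, β, w, _ =>
    comp_square ((rightUnitor_naturality (tensMap α)).symm.trans
      (congrArg (fun f => f ≫ (ρ_ _).hom) (tensorHom_id _ _).symm))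
      (tensCast_naturality h φ φ' α β w)
  | _ + 1, 0, h, _, _, _, _, _, _, _, _, _, _, _, _, _, _, _ => absurd h (Nat.succ_ne_zero _)
  | _ + 1, _ + 1, h, _, _, _, _, _, _, φ, φ', ψ, ψ', α, γ, β, w, w' =>
    comp_square (associator_inv_naturality (tensMap α) (tensMap fun j => γ j.castSucc)
        (γ (Fin.last _))).symm
      (tensor_square (append_naturality (Nat.succ.inj h)
        (fun i l hl => φ i l.castSucc hl) (fun i l hl => φ' i l.castSucc hl)
        (fun j l hl => ψ j.castSucc l.castSucc hl) (fun j l hl => ψ' j.castSucc l.castSucc hl)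
        α (fun j => γ j.castSucc) (fun l => β l.castSucc) (fun _ _ _ => w _ _ _)
        fun _ _ _ => w' _ _ _) (w' _ _ _))

/-- The recursion follows that of `flat`: one square for the blocks before the last, whiskered by
the last block, and one square for `append`. -/
theorem flat_naturality : {m : ℕ} → {k : Fin m → ℕ} → {N : ℕ} → (h : ∑ i, k i = N) →
    {X X' : ∀ i, Fin (k i) → M} → {Z Z' : Fin N → M} →
    (φ : ∀ (i : Fin m) (j : Fin (k i)) (l : Fin N),
      (l : ℕ) = finSigmaFinEquiv (n := k) ⟨i, j⟩ → (X i j ⟶ Z l)) →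
    (φ' : ∀ (i : Fin m) (j : Fin (k i)) (l : Fin N),
      (l : ℕ) = finSigmaFinEquiv (n := k) ⟨i, j⟩ → (X' i j ⟶ Z' l)) →
    (α : ∀ i j, X i j ⟶ X' i j) → (β : ∀ l, Z l ⟶ Z' l) →
    (∀ i j l hl, φ i j l hl ≫ β l = α i j ≫ φ' i j l hl) →
    flat h X Z φ ≫ tensMap β = tensMap (fun i => tensMap (α i)) ≫ flat h X' Z' φ'
  | 0, _, 0, _, _, _, _, _, _, _, _, _, _ => rfl
  | 0, _, _ + 1, h, _, _, _, _, _, _, _, _, _ => absurd h (by simp)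
  | m + 1, k, N, h, X, X', Z, Z', φ, φ', α, β, w =>
    comp_square
      (whiskerRight_square (tensMap (α (Fin.last m))) (flat_naturality (sum_castSucc h)
        (fun i j l hl => φ i.castSucc j _ (hl.trans (finSigmaFinEquiv_castSucc i j).symm))
        (fun i j l hl => φ' i.castSucc j _ (hl.trans (finSigmaFinEquiv_castSucc i j).symm))
        (fun i => α i.castSucc)
        (fun l => β ⟨l, lt_of_lt_of_le l.2 (Nat.sub_le _ _)⟩) fun _ _ _ _ => w _ _ _ _))
      (append_naturality _ _ _ _ _ _ _ _
        -- In the recursion of `flat` the maps on the first blocks are transports along an equality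
        -- of positions; once `l` is replaced by that position they are identities.
        (fun i l hl => by
          obtain rfl : l = ⟨i, lt_of_lt_of_le i.2 (Nat.sub_le _ _)⟩ := Fin.ext hl
          simp)
        fun _ _ _ => w _ _ _ _)

variable [SymmetricCategory M]

/-- `extract` branches through `Fin.lastCases`, which does not reduce by computation at a variable
position; this equation and the next one unfold its two branches. -/
theorem extract_last {n : ℕ} (X : Fin (n + 2) → M) (Y : Fin (n + 1) → M)
    (φ : ∀ j j', j = (Fin.last (n + 1)).succAbove j' → (X j ⟶ Y j')) :
    extract X (Fin.last (n + 1)) Y φ =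
      tensMap (fun j => φ j.castSucc j (Fin.succAbove_last_apply j).symm) ▷ _ :=
  congrFun (Fin.lastCases_last (motive := fun i =>
    (∀ j j', j = i.succAbove j' → (X j ⟶ Y j')) → (tens X ⟶ tens Y ⊗ X i))) φ

theorem extract_castSucc {n : ℕ} (X : Fin (n + 2) → M) (i : Fin (n + 1)) (Y : Fin (n + 1) → M)
    (φ : ∀ j j', j = i.castSucc.succAbove j' → (X j ⟶ Y j')) :
    extract X i.castSucc Y φ =
      (extract (fun j => X j.castSucc) i (fun j => Y j.castSucc)
          (fun j j' h => φ j.castSucc j'.castSucc (by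
            rw [h, Fin.castSucc_succAbove_castSucc])) ▷ X (Fin.last _)) ≫
        (α_ _ _ _).hom ≫ (_ ◁ (β_ _ _).hom) ≫ (α_ _ _ _).inv ≫
        ((_ ◁ φ (Fin.last _) (Fin.last _)
          (castSucc_succAbove_last' i).symm) ▷ _) :=
  congrFun (Fin.lastCases_castSucc (motive := fun i =>
    (∀ j j', j = i.succAbove j' → (X j ⟶ Y j')) → (tens X ⟶ tens Y ⊗ X i)) i) φ

theorem extract_naturality : {n : ℕ} → {X X' : Fin (n + 1) → M} → (i : Fin (n + 1)) →
    {Y Y' : Fin n → M} →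
    (φ : ∀ j j', j = i.succAbove j' → (X j ⟶ Y j')) →
    (φ' : ∀ j j', j = i.succAbove j' → (X' j ⟶ Y' j')) →
    (α : ∀ j, X j ⟶ X' j) → (β : ∀ j, Y j ⟶ Y' j) →
    (∀ j j' h, φ j j' h ≫ β j' = α j ≫ φ' j j' h) →
    extract X i Y φ ≫ (tensMap β ⊗ₘ α i) = tensMap α ≫ extract X' i Y' φ'
  | 0, X, X', i, _, _, φ, φ', α, β, w =>
    whiskerLeft_square (𝟙 (𝟙_ M)) (by
      -- With a single factor the only map involved is a transport from `X 0` to `X i`; identifying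
      -- `i` with the unique position turns it into an identity.
      obtain rfl : i = Fin.last 0 := Fin.ext (Nat.lt_one_iff.mp i.2)
      simp)
  | n + 1, X, X', i, Y, Y', φ, φ', α, β, w => by
    induction i using Fin.lastCases with
    | last =>
      rw [extract_last, extract_last]
      refine whiskerRight_square (α (Fin.last _)) ?_
      refine (tensMap_comp _ _).symm.trans (Eq.trans ?_ (tensMap_comp _ _))
      exact congrArg tensMap (funext fun j => w _ _ _)
    | cast i =>
      rw [extract_castSucc, extract_castSucc]
      -- The branch is a composite of five maps, so the square is pasted from five: the recursive
      -- call, the associator, the braiding, the inverse associator, and `φ` on the factor that was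
      -- passed over.
      refine comp_square (b := (tensMap (fun j => β j.castSucc) ⊗ₘ α i.castSucc) ⊗ₘ α (Fin.last _))
        (whiskerRight_square _ (extract_naturality i _
          (fun j j' h => φ' j.castSucc j'.castSucc (by rw [h, Fin.castSucc_succAbove_castSucc]))
          (fun j => α j.castSucc) _ fun _ _ _ => w _ _ _)) ?_
      refine comp_square (associator_naturality _ _ _).symm ?_
      refine comp_square (whiskerLeft_square _ (BraidedCategory.braiding_naturality _ _).symm) ?_
      refine comp_square (associator_inv_naturality _ _ _).symm ?_
      exact whiskerRight_square _ (whiskerLeft_square _ (w _ _ _))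

/-- The recursion of `permute` extracts the factor destined for the last place and permutes the
rest, so the square is `extract_naturality` followed by a tensor product of the recursive square
with `w`. -/
theorem permute_naturality : {m n : ℕ} → (e : Fin m ≃ Fin n) → {X X' : Fin n → M} →
    {Y Y' : Fin m → M} → (φ : ∀ j i, j = e i → (X j ⟶ Y i)) →
    (φ' : ∀ j i, j = e i → (X' j ⟶ Y' i)) → (α : ∀ j, X j ⟶ X' j) → (β : ∀ i, Y i ⟶ Y' i) →
    (∀ j i h, φ j i h ≫ β i = α j ≫ φ' j i h) →
    permute e X Y φ ≫ tensMap β = tensMap α ≫ permute e X' Y' φ'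
  | 0, 0, _, _, _, _, _, _, _, _, _, _ => rfl
  | 0, _ + 1, e, _, _, _, _, _, _, _, _, _ => (e.symm 0).elim0
  | _ + 1, 0, e, _, _, _, _, _, _, _, _, _ => (e 0).elim0
  | m + 1, _ + 1, e, _, _, _, _, φ, φ', α, β, w =>
    comp_square
      (extract_naturality (e (Fin.last m)) _ _ α
        (fun j => α ((e (Fin.last m)).succAbove j)) (by rintro _ _ rfl; simp))
      (tensor_square (permute_naturality (restrictEquiv e)
        (fun j i h => φ _ i.castSucc (by rw [h, succAbove_restrictEquiv]))
        (fun j i h => φ' _ i.castSucc (by rw [h, succAbove_restrictEquiv])) _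
        (fun i => β i.castSucc) fun _ _ _ => w _ _ _) (w _ _ _))

end TensorNaturality

/-! ### Operations of an algebra over the operad of an orthogonal category -/

section ActHom

variable {C : Type w} [Category.{w₁} C] {perp : Orthogonality C}
  {M : Type u} [Category.{v} M] [MonoidalCategory M] [SymmetricCategory M]

namespace OperadAlgebra

variable (A : OperadAlgebra (qftOperad perp) M)

/-- The structure morphism `A_{c₁} ⊗ ⋯ ⊗ A_{cₙ} ⟶ A_t` of the operation `[σ, f]`. -/
def actHom {n : ℕ} {c : Fin n → C} {t : C} (σ : Equiv.Perm (Fin n)) (f : ∀ i, c i ⟶ t) :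
    tens (fun i => A.obj (c i)) ⟶ A.obj t :=
  A.act (c := ⟨n, c⟩) (QFTOp.mk perp ⟨σ, f⟩)

/-- This is the commutativity encoded in the quotient: by `PreOp.rel_iff`, two orderings that agree
on every non-orthogonal pair represent the same operation. -/
theorem actHom_congr {n : ℕ} {c : Fin n → C} {t : C} {σ σ' : Equiv.Perm (Fin n)}
    (f : ∀ i, c i ⟶ t)
    (h : ∀ i j, ¬ perp.rel (f i) (f j) → (σ i < σ j ↔ σ' i < σ' j)) :
    A.actHom σ f = A.actHom σ' f :=
  congrArg (fun p => A.act (c := ⟨n, c⟩) p)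
    (QFTOp.sound ((PreOp.rel_iff perp (c := ⟨n, c⟩) ⟨σ, f⟩ ⟨σ', f⟩).mpr ⟨rfl, h⟩))

theorem act_qftOp_single {c t : C} (f : c ⟶ t) :
    A.act (c := Profile.single c) (qftOp perp fun _ => f) = (λ_ _).hom ≫ A.trans f :=
  A.act₁_eq f

theorem comp_mk {a : Profile C} {t : C} {b : Fin a.len → Profile C} (p : PreOp a t)
    (q : ∀ i, PreOp (b i) (a.color i)) :
    (qftOperad perp).comp (QFTOp.mk perp p) (fun i => QFTOp.mk perp (q i)) =
      QFTOp.mk perp (p.comp q) :=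
  QFTOp.comp_mk p q

/-- The composition axiom on representatives: two composites with equal underlying `PreOp` can then
be compared without passing through classes. -/
theorem act_comp_mk {a : Profile C} {t : C} {b : Fin a.len → Profile C} (p : PreOp a t)
    (q : ∀ i, PreOp (b i) (a.color i)) :
    flat rfl (fun i j => A.obj ((b i).color j)) (fun l => A.obj ((Profile.concat b).color l))
      (fun i j _ h => eqToHom (congrArg A.obj ((Profile.concat_color_pos b ⟨i, j⟩).symm.trans
        (congrArg (Profile.concat b).color (Fin.ext h).symm)))) ≫
        A.act (QFTOp.mk perp (p.comp q)) =
    tensMap (fun i => A.act (QFTOp.mk perp (q i))) ≫ A.act (QFTOp.mk perp p) := by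
  rw [← comp_mk]
  exact A.act_comp _ _

/-- Precomposition with operations of arity one. -/
theorem tensMap_trans_actHom {n : ℕ} {b c : Fin n → C} {t : C} (σ : Equiv.Perm (Fin n))
    (u : ∀ i, b i ⟶ c i) (f : ∀ i, c i ⟶ t) :
    tensMap (fun i => A.trans (u i)) ≫ A.actHom σ f = A.actHom σ (fun i => u i ≫ f i) := by
  have h₁ := A.act_comp_mk (a := ⟨n, c⟩) (b := fun i => Profile.single (b i))
    ⟨σ, f⟩ (fun i => ⟨1, fun _ => u i⟩)
  have h₂ := A.act_comp_mk (a := ⟨n, b⟩) (b := fun i => Profile.single (b i))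
    ⟨σ, fun i => u i ≫ f i⟩ (fun i => PreOp.unit (b i))
  -- The same operation is decomposed in two ways, as `f` after the `uᵢ` and as the `uᵢ ≫ fᵢ` after
  -- units. The block permutations coincide literally, so the permutation produced by composing with
  -- arity-one operations never has to be computed, and the two flattening maps cancel.
  have e : PreOp.comp (a := ⟨n, c⟩) (b := fun i => Profile.single (b i))
      ⟨σ, f⟩ (fun i => ⟨1, fun _ => u i⟩) =
      PreOp.comp (a := ⟨n, b⟩) (b := fun i => Profile.single (b i))
      ⟨σ, fun i => u i ≫ f i⟩ (fun i => PreOp.unit (b i)) :=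
    PreOp.ext rfl (funext fun x => (Category.id_comp _).symm)
  rw [e] at h₁
  have h := h₁.symm.trans h₂
  have : IsIso (tensMap fun i => (λ_ (A.obj (b i))).hom) := isIso_tensMap _
  rw [← cancel_epi (tensMap fun i => (λ_ (A.obj (b i))).hom), ← Category.assoc, ← tensMap_comp]
  refine Eq.trans ?_ (h.trans ?_)
  · congr 2
    funext i
    exact (A.act_qftOp_single (u i)).symm
  · congr 2
    funext i
    exact A.act_unit _

/-- Postcomposition with operations of arity one. -/
theorem actHom_trans {n : ℕ} {b : Fin n → C} {c t : C} (σ : Equiv.Perm (Fin n))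
    (f : ∀ i, b i ⟶ c) (g : c ⟶ t) :
    A.actHom σ f ≫ A.trans g = A.actHom σ (fun i => f i ≫ g) := by
  have h₁ := A.act_comp_mk (a := Profile.single c) (b := fun _ => ⟨n, b⟩)
    ⟨1, fun _ => g⟩ (fun _ => ⟨σ, f⟩)
  have h₂ := A.act_comp_mk (a := Profile.single t) (b := fun _ => ⟨n, b⟩)
    (PreOp.unit t) (fun _ => ⟨σ, fun i => f i ≫ g⟩)
  -- As for precomposition: `g` after `f` and a unit after `f ≫ g` have the same block permutation
  -- and the same morphisms.
  have e : PreOp.comp (a := Profile.single c) (b := fun _ => ⟨n, b⟩)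
      ⟨1, fun _ => g⟩ (fun _ => ⟨σ, f⟩) =
      PreOp.comp (a := Profile.single t) (b := fun _ => ⟨n, b⟩)
      (PreOp.unit t) (fun _ => ⟨σ, fun i => f i ≫ g⟩) :=
    PreOp.ext rfl (funext fun x => (Category.comp_id _).symm)
  rw [e] at h₁
  have h := h₁.symm.trans h₂
  replace h : (𝟙 (𝟙_ M) ⊗ₘ A.actHom σ f) ≫ A.act (c := Profile.single c) (qftOp perp fun _ => g) =
    (𝟙 (𝟙_ M) ⊗ₘ A.actHom σ fun i => f i ≫ g) ≫ A.act ((qftOperad perp).unit t) := h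
  rw [A.act_unit, A.act_qftOp_single, id_tensorHom, id_tensorHom, leftUnitor_naturality_assoc,
    leftUnitor_naturality, cancel_epi] at h
  exact h

theorem actHom_app {A B : OperadAlgebra (qftOperad perp) M} (φ : A ⟶ B) {n : ℕ} {c : Fin n → C}
    {t : C} (σ : Equiv.Perm (Fin n)) (f : ∀ i, c i ⟶ t) :
    A.actHom σ f ≫ φ.app t = tensMap (fun i => φ.app (c i)) ≫ B.actHom σ f :=
  φ.act_app (c := ⟨n, c⟩) _

end OperadAlgebra

end ActHom

/-! ### The algebra structure on the right Kan extension -/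

section RanAlgebra

variable {C : Type w} [Category.{w₁} C] {D : Type w₂} [Category.{w₁} D]
  {M : Type u} [Category.{v} M] [MonoidalCategory M] [SymmetricCategory M]
  {perp : Orthogonality D} {F : C ⥤ D}

/-- A pointwise right Kan extension along `F` of the diagram of objects that underlies an
algebra: for every `d`, a limit of the objects `A_c` over all `d ⟶ F c`. -/
structure PointwiseRan (A : OperadAlgebra (qftOperad (perp.pullback F)) M) where
  obj : D → M
  proj : ∀ {d : D} {c : C}, (d ⟶ F.obj c) → (obj d ⟶ A.obj c)
  proj_trans : ∀ {d : D} {c c' : C} (k : d ⟶ F.obj c) (u : c ⟶ c'),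
    proj k ≫ A.trans u = proj (k ≫ F.map u)
  hom_ext : ∀ {Y : M} {d : D} {f g : Y ⟶ obj d},
    (∀ (c : C) (k : d ⟶ F.obj c), f ≫ proj k = g ≫ proj k) → f = g
  exists_lift : ∀ {Y : M} {d : D} (s : ∀ c : C, (d ⟶ F.obj c) → (Y ⟶ A.obj c)),
    (∀ (c c' : C) (k : d ⟶ F.obj c) (u : c ⟶ c'), s c k ≫ A.trans u = s c' (k ≫ F.map u)) →
    ∃ l : Y ⟶ obj d, ∀ (c : C) (k : d ⟶ F.obj c), l ≫ proj k = s c k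

namespace PointwiseRan

variable {A : OperadAlgebra (qftOperad (perp.pullback F)) M} (X : PointwiseRan A)

/-- Compatibility of projections with the diagram absorbs the morphisms `hᵢ` into the projections
and leaves a pure multiplication in `A_c`. It is used in both directions: to normalize operations,
and in `tensMap_proj_actHom_congr` to bring lifted morphisms back into the operation. -/
theorem tensMap_proj_actHom {n : ℕ} {d : Fin n → D} {b : Fin n → C} {c : C}
    (σ : Equiv.Perm (Fin n)) (k : ∀ i, d i ⟶ F.obj (b i)) (h : ∀ i, b i ⟶ c) :
    tensMap (fun i => X.proj (k i)) ≫ A.actHom σ h =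
      tensMap (fun i => X.proj (k i ≫ F.map (h i))) ≫ A.actHom σ (fun _ => 𝟙 c) := by
  simp only [← X.proj_trans]
  rw [tensMap_comp, Category.assoc, A.tensMap_trans_actHom]
  simp only [Category.comp_id]

/-- The heart of the construction. The multiplication of `A_c` need not commute, but the factors
arrive along morphisms `fᵢ` into `F c`. Lifting each `fᵢ` to `lᵢ` in `C` exhibits the composite as
the action of `[σ, l]` on `A`, and orthogonality of the `fᵢ` becomes orthogonality of the `lᵢ` for
the pullback relation. -/
theorem tensMap_proj_actHom_congr (hF : IsFiberedInGroupoids F) {n : ℕ} {d : Fin n → D} {c : C}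
    (f : ∀ i, d i ⟶ F.obj c) {σ σ' : Equiv.Perm (Fin n)}
    (h : ∀ i j, ¬ perp.rel (f i) (f j) → (σ i < σ j ↔ σ' i < σ' j)) :
    tensMap (fun i => X.proj (f i)) ≫ A.actHom σ (fun _ => 𝟙 c) =
      tensMap (fun i => X.proj (f i)) ≫ A.actHom σ' (fun _ => 𝟙 c) := by
  choose b e l w using fun i => hF.exists_lift c (f i)
  have hf : f = fun i => eqToHom (e i).symm ≫ F.map (l i) := funext fun i => by simp [w]
  -- A lift has `F bᵢ` equal to `dᵢ` only propositionally, so `F lᵢ` is `fᵢ` precomposed with a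
  -- transport; stability of `⊥` under precomposition removes the transport.
  have hl := A.actHom_congr (σ := σ) (σ' := σ') l fun i j hij => h i j fun hc => hij (by
    change perp.rel (F.map (l i)) (F.map (l j))
    rw [w, w]
    exact perp.precomp _ _ hc)
  rw [hf, ← X.tensMap_proj_actHom, ← X.tensMap_proj_actHom, hl]

/-- The limit morphism is built from one representative `p₀`, and the formula is then shown for all
of them; quantifying over representatives is what makes the action well defined on the quotient. -/
theorem exists_act (hF : IsFiberedInGroupoids F) {d : Profile D} {t : D}
    (x : QFTOp perp d t) : ∃ l : tens (fun i => X.obj (d.color i)) ⟶ X.obj t,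
      ∀ (p : PreOp d t), QFTOp.mk perp p = x → ∀ (c : C) (g : t ⟶ F.obj c),
        l ≫ X.proj g =
          tensMap (fun i => X.proj (p.hom i ≫ g)) ≫ A.actHom p.perm (fun _ => 𝟙 c) := by
  obtain ⟨p₀, rfl⟩ := QFTOp.exists_rep x
  obtain ⟨l, hl⟩ := X.exists_lift (d := t) (fun c g =>
      tensMap (fun i => X.proj (p₀.hom i ≫ g)) ≫ A.actHom p₀.perm (fun _ => 𝟙 c))
    -- The cone condition: `A.trans u` is moved into the operation by `actHom_trans`, then into the
    -- projections by `tensMap_proj_actHom`.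
    fun c c' g u => by
      rw [Category.assoc, A.actHom_trans, X.tensMap_proj_actHom]
      simp only [Category.id_comp, Category.assoc]
  refine ⟨l, fun p hp c g => ?_⟩
  obtain ⟨h₁, h₂⟩ := (PreOp.rel_iff perp p p₀).mp (Quotient.exact hp)
  rw [hl, h₁]
  refine X.tensMap_proj_actHom_congr hF _ fun i j hij => ?_
  rw [← h₁] at hij
  -- An orthogonal pair in `p` stays orthogonal after postcomposition with `g`, so a pair that is
  -- not orthogonal after `g` was not orthogonal before, and its order is the same in both
  -- representatives.
  exact (h₂ i j fun hc => hij (perp.postcomp g hc)).symm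

/-- The structure morphisms of the right Kan extension of an algebra. -/
noncomputable def act (hF : IsFiberedInGroupoids F) {d : Profile D} {t : D}
    (x : QFTOp perp d t) : tens (fun i => X.obj (d.color i)) ⟶ X.obj t :=
  (X.exists_act hF x).choose

theorem act_proj (hF : IsFiberedInGroupoids F) {d : Profile D} {t : D} (p : PreOp d t) {c : C}
    (g : t ⟶ F.obj c) :
    X.act hF (QFTOp.mk perp p) ≫ X.proj g =
      tensMap (fun i => X.proj (p.hom i ≫ g)) ≫ A.actHom p.perm (fun _ => 𝟙 c) :=
  (X.exists_act hF (QFTOp.mk perp p)).choose_spec p rfl c g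

theorem eqToHom_proj {d d' : D} {c : C} (h : d = d') (k : d' ⟶ F.obj c) (k' : d ⟶ F.obj c)
    (hk : HEq k' k) : eqToHom (congrArg X.obj h) ≫ X.proj k = X.proj k' := by
  subst h
  rw [eq_of_heq hk]
  exact Category.id_comp _

/-- After `proj g`, naturality of `permute` carries the claim to the factors `A_c`, where it is the
permutation axiom of `A` for a constant profile. -/
theorem act_relabel (hF : IsFiberedInGroupoids F) {d d' : Profile D} {t : D} (s : d ⟶ d')
    (x : QFTOp perp d t) :
    permute s.equiv (fun i => X.obj (d.color i)) (fun i => X.obj (d'.color i))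
      (fun _ i h => eqToHom (congrArg X.obj ((congrArg d.color h).trans (s.color_eq i).symm))) ≫
      X.act hF (QFTOp.relabel s x) = X.act hF x := by
  obtain ⟨p, rfl⟩ := QFTOp.exists_rep x
  refine X.hom_ext fun c g => ?_
  -- The same bijection of positions, viewed between profiles of constant color `c`; the transports
  -- in the axiom of `A` are then identities.
  let s' : (⟨d.len, fun _ => c⟩ : Profile C) ⟶ ⟨d'.len, fun _ => c⟩ := ⟨s.equiv, fun _ => rfl⟩
  rw [QFTOp.relabel_mk, X.act_proj hF p g, Category.assoc, X.act_proj hF (p.relabel s) g,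
    ← Category.assoc, permute_naturality s.equiv _ (fun _ _ _ => 𝟙 (A.obj c))
      (fun i => X.proj (p.hom i ≫ g)) _ fun j i h => ?_, Category.assoc]
  · refine congrArg (fun f => _ ≫ f) (Eq.trans (congrArg (fun f => _ ≫ f) ?_)
      (A.act_relabel s' (QFTOp.mk _ ⟨p.perm, fun _ => 𝟙 c⟩)))
    refine congrArg (fun q => A.act (c := ⟨d'.len, fun _ => c⟩) (QFTOp.mk _ q)) ?_
    exact PreOp.ext rfl (funext fun i => (Category.id_comp _).symm)
  · subst h
    rw [Category.comp_id]
    refine X.eqToHom_proj (s.color_eq i).symm _ _ ?_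
    exact PreOp.comp_heq (s.color_eq i).symm (p.relabel_hom_heq s i).symm rfl

/-- Both sides are determined by their composites with `proj g`. There the flattening map is moved
past the projections to copies of `A_c`, and the composition axiom of `A` with all morphisms equal
to `𝟙 c` finishes. -/
theorem act_comp (hF : IsFiberedInGroupoids F) {a : Profile D} {t : D} {b : Fin a.len → Profile D}
    (x : QFTOp perp a t) (y : ∀ i, QFTOp perp (b i) (a.color i)) :
    flat rfl (fun i j => X.obj ((b i).color j)) (fun l => X.obj ((Profile.concat b).color l))
      (fun i j _ h => eqToHom (congrArg X.obj ((Profile.concat_color_pos b ⟨i, j⟩).symm.trans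
        (congrArg (Profile.concat b).color (Fin.ext h).symm)))) ≫ X.act hF (QFTOp.comp x y) =
    tensMap (fun i => X.act hF (y i)) ≫ X.act hF x := by
  obtain ⟨p, rfl⟩ := QFTOp.exists_rep x
  obtain ⟨q, rfl⟩ := QFTOp.exists_rep_pi y
  refine X.hom_ext fun c g => ?_
  have h₁ := X.act_proj hF (p.comp q) g
  have h₂ := A.act_comp_mk (a := ⟨a.len, fun _ => c⟩) (b := fun i => ⟨(b i).len, fun _ => c⟩)
    ⟨p.perm, fun _ => 𝟙 c⟩ fun i => ⟨(q i).perm, fun _ => 𝟙 c⟩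
  -- The permutation of a composite depends only on the permutations and the block lengths, not on
  -- colors, so it is the same for the constant profiles.
  have h₃ : PreOp.comp (a := ⟨a.len, fun _ => c⟩) (b := fun i => ⟨(b i).len, fun _ => c⟩)
      ⟨p.perm, fun _ => 𝟙 c⟩ (fun i => ⟨(q i).perm, fun _ => 𝟙 c⟩) =
      ⟨(p.comp q).perm, fun _ => 𝟙 c⟩ :=
    PreOp.ext rfl (funext fun _ => Category.comp_id _)
  rw [h₃] at h₂
  -- The upper row flattens the limit objects by transports, the lower row flattens copies of `A_c`
  -- by identities, and the columns are the projections along the composites into `F c`.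
  have h₄ := flat_naturality rfl (X := fun i j => X.obj ((b i).color j))
    (X' := fun i j => A.obj c)
    (Z := fun l => X.obj ((Profile.concat b).color l))
    (fun i j _ h => eqToHom (congrArg X.obj ((Profile.concat_color_pos b ⟨i, j⟩).symm.trans
        (congrArg (Profile.concat b).color (Fin.ext h).symm))))
    (fun i j _ h => 𝟙 _)
    (fun i j => X.proj ((q i).hom j ≫ p.hom i ≫ g))
    (fun l => X.proj ((p.comp q).hom l ≫ g)) (by
      intro i j l hl
      obtain ⟨z, rfl⟩ := (Profile.pos b).surjective l
      obtain rfl : z = ⟨i, j⟩ := (Profile.pos b).injective (Fin.ext hl)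
      rw [Category.comp_id, ← Category.assoc]
      exact X.eqToHom_proj (Profile.concat_color_pos b ⟨i, j⟩).symm _ _ (PreOp.comp_heq (Profile.concat_color_pos b ⟨i, j⟩).symm
        (p.comp_hom_heq q ⟨i, j⟩).symm rfl))
  -- The chain: evaluate the composite operation under `proj g`, slide the flattening map (`h₄`),
  -- split the multiplication in `A_c` (`h₂`), then recognize the inner actions projected along
  -- `p.hom i ≫ g` and the outer action projected along `g`.
  calc
    _ = _ := Category.assoc _ _ _
    _ = _ := congrArg (fun f => _ ≫ f) ((congrArg (fun z => X.act hF z ≫ X.proj g)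
      (QFTOp.comp_mk p q)).trans h₁)
    _ = _ := (Category.assoc _ _ _).symm
    _ = _ := congrArg (fun f => f ≫ _) h₄
    _ = _ := Category.assoc _ _ _
    _ = _ := congrArg (fun f => _ ≫ f) h₂
    _ = _ := (Category.assoc _ _ _).symm
    _ = _ := congrArg (fun f => f ≫ _) ((tensMap_comp _ _).symm.trans
      (congrArg tensMap (funext fun i => (X.act_proj hF (q i) (p.hom i ≫ g)).symm)))
    _ = _ := congrArg (fun f => f ≫ _) (tensMap_comp _ _)
    _ = _ := Category.assoc _ _ _
    _ = _ := congrArg (fun f => _ ≫ f) (X.act_proj hF p g).symm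
    _ = _ := (Category.assoc _ _ _).symm

theorem act_unary_proj (hF : IsFiberedInGroupoids F) {d t : D} {c : C} (f : d ⟶ t)
    (g : t ⟶ F.obj c) :
    X.act hF (d := Profile.single d) (QFTOp.mk perp ⟨1, fun _ => f⟩) ≫ X.proj g =
      (λ_ _).hom ≫ X.proj (f ≫ g) := by
  refine (X.act_proj hF _ g).trans ?_
  refine Eq.trans ?_ (leftUnitor_naturality (X.proj (f ≫ g)))
  rw [← id_tensorHom]
  exact congrArg (fun h => (𝟙 (𝟙_ M) ⊗ₘ X.proj (f ≫ g)) ≫ h) (A.act_unit c)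

theorem act_unit (hF : IsFiberedInGroupoids F) (t : D) :
    X.act hF (QFTOp.mk perp (PreOp.unit t)) = (λ_ (X.obj t)).hom :=
  X.hom_ext fun _ g => (X.act_unary_proj hF (𝟙 t) g).trans
    (congrArg (fun k => (λ_ (X.obj t)).hom ≫ X.proj k) (Category.id_comp g))

/-- The right Kan extension of an algebra along a category fibered in groupoids. -/
noncomputable def algebra (hF : IsFiberedInGroupoids F) : OperadAlgebra (qftOperad perp) M where
  obj := X.obj
  act := X.act hF
  act_relabel := X.act_relabel hF
  act_comp := X.act_comp hF
  act_unit := X.act_unit hF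

theorem algebra_trans_proj (hF : IsFiberedInGroupoids F) {d t : D} {c : C} (f : d ⟶ t)
    (g : t ⟶ F.obj c) : (X.algebra hF).trans f ≫ X.proj g = X.proj (f ≫ g) := by
  refine (Category.assoc _ _ _).trans ?_
  refine (congrArg (fun h => (λ_ (X.obj d)).inv ≫ h) (X.act_unary_proj hF f g)).trans ?_
  exact Iso.inv_hom_id_assoc _ _

theorem algebra_one_proj (hF : IsFiberedInGroupoids F) {d : D} {c : C} (g : d ⟶ F.obj c) :
    (X.algebra hF).one d ≫ X.proj g = A.one c :=
  (X.act_proj hF (d := ⟨0, fun _ => d⟩) ⟨1, fun _ => 𝟙 d⟩ g).trans (Category.id_comp _)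

/-- Together with `algebra_one_proj` this says that every projection is a monoid morphism, which
pins down the monoid structure on the limit and later identifies it with that of `F.ran`. -/
theorem algebra_mul_proj (hF : IsFiberedInGroupoids F) {d : D} {c : C} (g : d ⟶ F.obj c) :
    (X.algebra hF).mul d ≫ X.proj g = (X.proj g ⊗ₘ X.proj g) ≫ A.mul c := by
  have h := X.act_proj hF (d := ⟨2, fun _ => d⟩) ⟨1, fun _ => 𝟙 d⟩ g
  simp only [Category.id_comp] at h
  refine (Category.assoc _ _ _).trans ?_
  refine (congrArg (fun h => ((λ_ (X.obj d)).inv ▷ X.obj d) ≫ h) h).trans ?_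
  change _ ≫ ((𝟙 (𝟙_ M) ⊗ₘ X.proj g) ⊗ₘ X.proj g) ≫ A.act₂ (𝟙 c) = _ ≫ _ ≫ _
  rw [← Category.assoc, ← Category.assoc]
  congr 1
  monoidal

/-- The projection at identities is a morphism of algebras. -/
noncomputable def counit (hF : IsFiberedInGroupoids F) :
    ((qftOperadMap (perp.pullback F) perp F (isOrthogonal_pullback perp F)).pullback M).obj
      (X.algebra hF) ⟶ A where
  app c := X.proj (𝟙 (F.obj c))
  act_app {c t} x := by
    obtain ⟨p, rfl⟩ := QFTOp.exists_rep x
    refine (X.act_proj hF (p.mapFunctor F) (𝟙 (F.obj t))).trans ?_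
    -- The projections at identities absorb the morphisms of `p`, giving the projections along
    -- `F.map (p.hom i)` that define the action on the limit.
    refine Eq.trans ?_ (X.tensMap_proj_actHom p.perm (fun i => 𝟙 (F.obj (c.color i))) p.hom).symm
    congr 2
    funext i
    exact congrArg X.proj ((Category.comp_id _).trans (Category.id_comp _).symm)

/-! ### The universal property of the extended algebra -/

section Lift

variable {B : OperadAlgebra (qftOperad perp) M}
  (φ : ((qftOperadMap (perp.pullback F) perp F (isOrthogonal_pullback perp F)).pullback M).obj B ⟶
    A)

/-- The maps `B_d ⟶ B_{F c} ⟶ A_c` form a cone because `φ` is natural with respect to the morphisms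
of `C`. -/
theorem exists_liftApp (d : D) : ∃ l : B.obj d ⟶ X.obj d,
    ∀ (c : C) (k : d ⟶ F.obj c), l ≫ X.proj k = B.trans k ≫ φ.app c :=
  X.exists_lift (fun c k => B.trans k ≫ φ.app c) fun c c' k u => by
    refine (Category.assoc _ _ _).trans ?_
    refine (congrArg (fun f => B.trans k ≫ f) (OperadAlgebra.app_trans φ u).symm).trans ?_
    refine (Category.assoc _ _ _).symm.trans ?_
    exact congrArg (fun f => f ≫ φ.app c') (B.trans_comp k (F.map u)).symm

/-- The components of the morphism to a right Kan extension that corresponds to `φ`. -/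
noncomputable def liftApp (d : D) : B.obj d ⟶ X.obj d := (X.exists_liftApp φ d).choose

theorem liftApp_proj {d : D} {c : C} (k : d ⟶ F.obj c) :
    X.liftApp φ d ≫ X.proj k = B.trans k ≫ φ.app c :=
  (X.exists_liftApp φ d).choose_spec c k

/-- The morphism to a right Kan extension that corresponds to `φ`. -/
noncomputable def lift (hF : IsFiberedInGroupoids F) : B ⟶ X.algebra hF where
  app := X.liftApp φ
  act_app {d t} x := by
    obtain ⟨p, rfl⟩ := QFTOp.exists_rep x
    refine X.hom_ext fun c g => ?_
    have h₁ := X.act_proj hF p g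
    have h₂ := B.actHom_trans p.perm p.hom g
    have h₃ := OperadAlgebra.actHom_app φ p.perm (fun _ => 𝟙 c)
    -- The morphism `φ` respects only operations coming from `C`. The operation of `B` with
    -- morphisms `p.hom i ≫ g` is therefore split into transport along them and a multiplication in
    -- `B_{F c}`, whose morphisms `F.map (𝟙 c)` do come from `C`.
    have h₄ : tensMap (fun i => B.trans (p.hom i ≫ g)) ≫
        B.actHom p.perm (fun _ => F.map (𝟙 c)) = B.actHom p.perm (fun i => p.hom i ≫ g) := by
      rw [B.tensMap_trans_actHom]
      simp only [F.map_id, Category.comp_id]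
    calc
      _ = _ := Category.assoc _ _ _
      _ = _ := congrArg (fun f => _ ≫ f) (X.liftApp_proj φ g)
      _ = _ := (Category.assoc _ _ _).symm
      _ = _ := congrArg (fun f => f ≫ φ.app c) (h₂.trans h₄.symm)
      _ = _ := Category.assoc _ _ _
      _ = _ := congrArg (fun f => _ ≫ f) h₃
      _ = _ := (Category.assoc _ _ _).symm
      _ = _ := congrArg (fun f => f ≫ _) ((tensMap_comp _ _).symm.trans (congrArg tensMap
        (funext fun i => (X.liftApp_proj φ (p.hom i ≫ g)).symm)))
      _ = _ := congrArg (fun f => f ≫ _) (tensMap_comp _ _)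
      _ = _ := Category.assoc _ _ _
      _ = _ := congrArg (fun f => _ ≫ f) h₁.symm
      _ = _ := (Category.assoc _ _ _).symm

theorem pullback_map_lift_counit (hF : IsFiberedInGroupoids F) :
    ((qftOperadMap (perp.pullback F) perp F (isOrthogonal_pullback perp F)).pullback M).map
      (X.lift φ hF) ≫ X.counit hF = φ := by
  ext c
  refine (X.liftApp_proj φ (𝟙 (F.obj c))).trans ?_
  rw [B.trans_id]
  exact Category.id_comp _

/-- Uniqueness of lifts: `proj k` equals the action of `k` on the limit followed by `proj (𝟙 _)`,
and `ψ` commutes with the action of `k`, so the component of `ψ` at `d` is recovered from `ψ`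
followed by the counit. -/
theorem lift_pullback_map_counit (hF : IsFiberedInGroupoids F) (ψ : B ⟶ X.algebra hF) :
    X.lift (((qftOperadMap (perp.pullback F) perp F
      (isOrthogonal_pullback perp F)).pullback M).map ψ ≫ X.counit hF) hF = ψ := by
  ext d
  refine X.hom_ext fun c k => (X.liftApp_proj _ k).trans ?_
  have h := X.algebra_trans_proj hF k (𝟙 _)
  rw [Category.comp_id] at h
  rw [← h]
  refine Eq.trans ?_ ((congrArg (fun f => f ≫ X.proj (𝟙 _))
    (OperadAlgebra.app_trans ψ k)).trans (Category.assoc _ _ _))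
  exact (Category.assoc _ _ _).symm

end Lift

end PointwiseRan

end RanAlgebra

/-! ### The orbifoldization functor and its comparison with the right Kan extension of monoids -/

section Orbifoldization

variable {C D : Type w} [SmallCategory C] [SmallCategory D]
  {M : Type u} [Category.{v} M] [MonoidalCategory M] [HasLimitsOfSize.{w, w} M] {F : C ⥤ D}

/-- The projection from the right Kan extension of a diagram of monoids along `F`. -/
noncomputable def ranProj (F : C ⥤ D) (G : C ⥤ Mon M) {d : D} {c : C} (k : d ⟶ F.obj c) :
    (F.ran.obj G).obj d ⟶ G.obj c :=
  (F.ran.obj G).map k ≫ (F.ranCounit.app G).app c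

theorem map_ranProj (G : C ⥤ Mon M) {d' d : D} {c : C} (f : d' ⟶ d) (k : d ⟶ F.obj c) :
    (F.ran.obj G).map f ≫ ranProj F G k = ranProj F G (f ≫ k) := by
  simp [ranProj]

theorem ranProj_map (G : C ⥤ Mon M) {d : D} {c c' : C} (k : d ⟶ F.obj c) (u : c ⟶ c') :
    ranProj F G k ≫ G.map u = ranProj F G (k ≫ F.map u) := by
  have h := (F.ranCounit.app G).naturality u
  rw [ranProj, ranProj, Category.assoc, Functor.map_comp, Category.assoc]
  exact congrArg (fun f => _ ≫ f) h.symm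

theorem ran_map_app_ranProj {G G' : C ⥤ Mon M} (τ : G ⟶ G') {d : D} {c : C} (k : d ⟶ F.obj c) :
    (F.ran.map τ).app d ≫ ranProj F G' k = ranProj F G k ≫ τ.app c := by
  have h := congr_app (F.ranCounit.naturality τ) c
  rw [ranProj, ranProj, Category.assoc, ← NatTrans.naturality_assoc]
  exact congrArg (fun f => _ ≫ f) h

/-- The underlying objects of the right Kan extension of a diagram of monoids are limits. -/
noncomputable def isLimitRanProj (G : C ⥤ Mon M) (d : D) :
    IsLimit ((Mon.forget M).mapCone
      ((Functor.RightExtension.mk _ (F.ranCounit.app G)).coneAt d)) :=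
  -- `F.ran` is pointwise, so its value at `d` is a limit of monoids over the structured arrows from
  -- `d`; forgetting the monoid structure preserves it. This is what allows non-monoid test objects
  -- in `PointwiseRan`.
  isLimitOfPreserves (Mon.forget M) (F.isPointwiseRightKanExtensionRanCounit G d)

variable [SymmetricCategory M] {perp : Orthogonality D}

/-- The right Kan extension along `F` of the underlying diagram of monoids of an algebra. -/
noncomputable def pointwiseRan (A : OperadAlgebra (qftOperad (perp.pullback F)) M) :
    PointwiseRan A where
  obj d := ((F.ran.obj A.toMon).obj d).X
  proj k := (ranProj F A.toMon k).hom
  proj_trans k u := congrArg Mon.Hom.hom (ranProj_map A.toMon k u)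
  hom_ext {Y d f g} h := (isLimitRanProj A.toMon d).hom_ext fun j => h j.right j.hom
  exists_lift {Y d} s hs :=
    ⟨(isLimitRanProj A.toMon d).lift
      { pt := Y
        π :=
          { app := fun j => s j.right j.hom
            naturality := fun j j' u => by
              refine (Category.id_comp _).trans ?_
              have := hs _ _ j.hom u.right
              -- A morphism of structured arrows is a `u` in `C` with `j.hom ≫ F.map u = j'.hom`, so
              -- the compatibility of `s` is naturality of the cone.
              rw [StructuredArrow.w u] at this
              exact this.symm } },
      fun c k => (isLimitRanProj A.toMon d).fac _ (StructuredArrow.mk k)⟩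

/-- The identity is an isomorphism from the monoid of the right Kan extension of an algebra
to the value of the right Kan extension of the underlying diagram of monoids. -/
noncomputable def orbifoldMonIso (hF : IsFiberedInGroupoids F)
    (A : OperadAlgebra (qftOperad (perp.pullback F)) M) (d : D) :
    ((pointwiseRan A).algebra hF).toMon.obj d ≅ (F.ran.obj A.toMon).obj d :=
  Mon.mkIso (Iso.refl ((F.ran.obj A.toMon).obj d).X)
    ((Category.comp_id _).trans ((pointwiseRan A).hom_ext fun _ k =>
      ((pointwiseRan A).algebra_one_proj hF k).trans
        (IsMonHom.one_hom (ranProj F A.toMon k).hom).symm))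
    ((Category.comp_id _).trans (Eq.trans ((pointwiseRan A).hom_ext fun _ k =>
      ((pointwiseRan A).algebra_mul_proj hF k).trans
        (IsMonHom.mul_hom (ranProj F A.toMon k).hom).symm)
        ((congrArg (fun f => f ≫ _) (id_tensorHom_id _ _)).trans (Category.id_comp _)).symm))

/-- Morphisms to the right Kan extension of an algebra. -/
noncomputable def orbifoldHomEquiv (hF : IsFiberedInGroupoids F)
    (B : OperadAlgebra (qftOperad perp) M)
    (A : OperadAlgebra (qftOperad (perp.pullback F)) M) :
    (((qftOperadMap (perp.pullback F) perp F (isOrthogonal_pullback perp F)).pullback M).obj B ⟶ A)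
      ≃ (B ⟶ (pointwiseRan A).algebra hF) where
  toFun φ := (pointwiseRan A).lift φ hF
  invFun ψ := ((qftOperadMap (perp.pullback F) perp F
    (isOrthogonal_pullback perp F)).pullback M).map ψ ≫ (pointwiseRan A).counit hF
  left_inv φ := (pointwiseRan A).pullback_map_lift_counit φ hF
  right_inv ψ := (pointwiseRan A).lift_pullback_map_counit hF ψ

/-- Naturality in the source algebra alone suffices: representability then supplies both the action
of the right adjoint on morphisms and naturality in `A`. On the inverse side it is just
functoriality of the pullback. -/
theorem orbifoldHomEquiv_naturality (hF : IsFiberedInGroupoids F)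
    (B' B : OperadAlgebra (qftOperad perp) M)
    (A : OperadAlgebra (qftOperad (perp.pullback F)) M) (f : B' ⟶ B)
    (φ : ((qftOperadMap (perp.pullback F) perp F
      (isOrthogonal_pullback perp F)).pullback M).obj B ⟶ A) :
    orbifoldHomEquiv hF B' A (((qftOperadMap (perp.pullback F) perp F
      (isOrthogonal_pullback perp F)).pullback M).map f ≫ φ) = f ≫ orbifoldHomEquiv hF B A φ := by
  rw [← Equiv.eq_symm_apply]
  refine (congrArg (fun g => ((qftOperadMap (perp.pullback F) perp F
    (isOrthogonal_pullback perp F)).pullback M).map f ≫ g)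
      ((orbifoldHomEquiv hF B A).symm_apply_apply φ).symm).trans ?_
  exact (Category.assoc _ _ _).symm

theorem orbifoldHomEquiv_symm_id (hF : IsFiberedInGroupoids F)
    (A : OperadAlgebra (qftOperad (perp.pullback F)) M) :
    (orbifoldHomEquiv hF _ A).symm (𝟙 _) = (pointwiseRan A).counit hF := by
  ext c
  exact Category.id_comp _

/-- The orbifoldization functor. -/
noncomputable def orbifoldization (hF : IsFiberedInGroupoids F) :
    OperadAlgebra (qftOperad (perp.pullback F)) M ⥤ OperadAlgebra (qftOperad perp) M :=
  Adjunction.rightAdjointOfEquiv (orbifoldHomEquiv hF) (orbifoldHomEquiv_naturality hF)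

/-- The orbifoldization functor is right adjoint to the pullback of algebras. -/
noncomputable def orbifoldizationAdjunction (hF : IsFiberedInGroupoids F) :
    (qftOperadMap (perp.pullback F) perp F (isOrthogonal_pullback perp F)).pullback M ⊣
      orbifoldization (M := M) hF :=
  Adjunction.adjunctionOfEquivRight (orbifoldHomEquiv hF) (orbifoldHomEquiv_naturality hF)

theorem orbifoldizationAdjunction_counit_app (hF : IsFiberedInGroupoids F)
    (A : OperadAlgebra (qftOperad (perp.pullback F)) M) :
    (orbifoldizationAdjunction hF).counit.app A = (pointwiseRan A).counit hF := by
  refine Eq.trans (b := (orbifoldHomEquiv hF _ A).symm (𝟙 _)) ?_ ?_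
  · simp [orbifoldizationAdjunction, Adjunction.adjunctionOfEquivRight]
  · exact orbifoldHomEquiv_symm_id hF A

/-- The right adjoint acts on morphisms by representability; this identifies that action with the
map induced on limits, as needed for naturality of the comparison with `F.ran`. -/
theorem orbifoldization_map_proj (hF : IsFiberedInGroupoids F)
    {A B : OperadAlgebra (qftOperad (perp.pullback F)) M} (φ : A ⟶ B) {d : D} {c : C}
    (k : d ⟶ F.obj c) :
    ((orbifoldization hF).map φ).app d ≫ (pointwiseRan B).proj k =
      (pointwiseRan A).proj k ≫ φ.app c := by
  -- By construction the image of `φ` is the transpose of the counit at `A` followed by `φ`.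
  have h : (orbifoldization hF).map φ = (pointwiseRan B).lift ((pointwiseRan A).counit hF ≫ φ) hF :=
    congrArg (orbifoldHomEquiv hF _ B) (congrArg (fun f => f ≫ φ)
      (orbifoldHomEquiv_symm_id hF A))
  rw [h]
  refine ((pointwiseRan B).liftApp_proj _ k).trans ?_
  refine (Category.assoc _ _ _).symm.trans (congrArg (fun f => f ≫ φ.app c) ?_)
  exact ((pointwiseRan A).algebra_trans_proj hF k (𝟙 _)).trans
    (congrArg (fun f => (pointwiseRan A).proj f) (Category.comp_id k))

/-- The orbifoldization functor is given by right Kan extension on the underlying diagrams of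
monoids. -/
noncomputable def orbifoldizationUnderlying (hF : IsFiberedInGroupoids F) :
    orbifoldization hF ⋙ underlying perp M ≅ underlying (perp.pullback F) M ⋙ F.ran :=
  NatIso.ofComponents
    (fun A => NatIso.ofComponents (fun d => orbifoldMonIso hF A d) fun {d t} f => by
      ext
      refine (Category.comp_id _).trans (Eq.trans ?_ (Category.id_comp _).symm)
      exact (pointwiseRan A).hom_ext fun c k => ((pointwiseRan A).algebra_trans_proj hF f k).trans
        (congrArg Mon.Hom.hom (map_ranProj A.toMon f k)).symm)
    fun {A B} φ => by
      ext d
      refine (Category.comp_id _).trans (Eq.trans ?_ (Category.id_comp _).symm)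
      refine (pointwiseRan B).hom_ext fun c k => ?_
      exact (orbifoldization_map_proj hF φ k).trans
        (congrArg Mon.Hom.hom (ran_map_app_ranProj ((underlying _ M).map φ) k)).symm

end Orbifoldization

end AQFT

theorem mainTheorem10 {C D : Type w} [SmallCategory C] [SmallCategory D]
    {M : Type u} [Category.{v} M] [MonoidalCategory M] [SymmetricCategory M] [MonoidalClosed M]
    [HasLimitsOfSize.{w, w} M] [HasColimitsOfSize.{w, w} M]
    (perp : AQFT.Orthogonality D) (F : C ⥤ D) (hF : AQFT.IsFiberedInGroupoids F) :
    ∃ (R : AQFT.OperadAlgebra (AQFT.qftOperad (perp.pullback F)) M ⥤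
        AQFT.OperadAlgebra (AQFT.qftOperad perp) M)
      (adj : (AQFT.qftOperadMap (perp.pullback F) perp F
        (AQFT.isOrthogonal_pullback perp F)).pullback M ⊣ R)
      (e : R ⋙ AQFT.underlying perp M ≅ AQFT.underlying (perp.pullback F) M ⋙ F.ran),
      ∀ A, Functor.whiskerLeft F (e.hom.app A) ≫
          F.ranCounit.app ((AQFT.underlying (perp.pullback F) M).obj A) =
        (AQFT.underlyingPullback (perp.pullback F) M F
            (AQFT.isOrthogonal_pullback perp F)).inv.app (R.obj A) ≫
          (AQFT.underlying (perp.pullback F) M).map (adj.counit.app A) := by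
  refine ⟨AQFT.orbifoldization hF, AQFT.orbifoldizationAdjunction hF,
    AQFT.orbifoldizationUnderlying hF, fun A => ?_⟩
  rw [AQFT.orbifoldizationAdjunction_counit_app]
  ext c
  refine Eq.trans (Category.id_comp _) (Eq.trans ?_ (Category.id_comp _).symm)
  -- The comparison isomorphisms on both sides have identity components, so what remains is that the
  -- projection at `𝟙 (F c)`, which is the image of that identity under the Kan extension followed
  -- by its counit, equals the counit.
  refine congrArg Mon.Hom.hom (Eq.trans ?_ (congrArg (fun f => f ≫ _)
    ((F.ran.obj A.toMon).map_id _)).symm)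
  exact (Category.id_comp _).symm
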